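/- Let $d\ge 1$, $\gamma>0$, and let $\{\xi(z):z\in\mathbb Z^d\}$ be independent identically distributed random variables with $\mathbb P\{\xi(z)<x\}=1-e^{-x^\gamma}$ for $x\ge 0$. Let $|\cdot|$ denote the $\ell^1$-norm. For $c\in\mathbb R$, all sufficiently large $t$ and $z\in\mathbb Z^d$ put $$\Psi_{t,c}(z)=\xi(z)-\frac{|z|}{\gamma t}\log\log t+\frac{c|z|}{t},\qquad \Psi_t=\Psi_{t,0},$$ $$r_t=\frac{t(\log t)^{1/\gamma-1}}{\log\log t},\quad a_t=(d\log t)^{1/\gamma},\quad d_t=(d\log t)^{1/\gamma-1},\quad \theta=\gamma^{-1}d^{1-1/\gamma}.$$ Let $Z_t^{(1,c)}$ and $Z_t^{(2,c)}$ be random points of $\mathbb Z^d$ with $\Psi_{t,c}(Z_t^{(1,c)})=\max_{z\in\mathbb Z^d}\Psi_{t,c}(z)$ and $\Psi_{t,c}(Z_t^{(2,c)})=\max_{z\ne Z_t^{(1,c)}}\Psi_{t,c}(z)$, $Z_t^{(2,c)}\neq Z_t^{(1,c)}$, whenever these maxima exist, and write $Z_t^{(i)}=Z_t^{(i,0)}$.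 Let $c\in\mathbb R$. (a) As $t\to\infty$, the random vector $$\left(\frac{Z_t^{(1,c)}}{r_t},\ \frac{\Psi_{t,c}(Z_t^{(1,c)})-a_{r_t}}{d_{r_t}},\ \frac{Z_t^{(2,c)}}{r_t},\ \frac{\Psi_{t,c}(Z_t^{(2,c)})-a_{r_t}}{d_{r_t}}\right)$$ converges in law to a random vector in $\mathbb R^d\times\mathbb R\times\mathbb R^d\times\mathbb R$ with density $$p(x_1,y_1,x_2,y_2)=\gamma^2\exp\left\{-\gamma\big(y_1+y_2+\theta|x_1|+\theta|x_2|\big)-2^d(\gamma\theta)^{-d}e^{-\gamma y_2}\right\}\mathbf 1_{\{y_1>y_2\}}.$$ (b) Let $f_t\to0$, $g_t\to\infty$, $\lambda_t\to0$, $\rho_t\to0$ (as $t\to\infty$) be positive functions such that $f_t^{-1},g_t,\lambda_t^{-1},\rho_t^{-1}$ are $o(\log\log t)$ and $g_t\rho_t\lambda_t^{-1}\to0$. Then the event $$\mathcal E_c(t)=\Big\{r_tf_t<|Z_t^{(1)}|<r_tg_t,\ \Psi_t(Z_t^{(1)})-\Psi_t(Z_t^{(2)})>d_t\lambda_t,\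 \Psi_t(Z_t^{(1)})>a_{r_t}-d_tg_t,$$ $$\Psi_t(Z_t^{(2)})>a_{r_t}-d_tg_t,\ |Z_t^{(1,c)}|<r_tg_t,\ |Z_t^{(2,c)}|<r_tg_t\Big\}$$ satisfies $\mathbb P\{\mathcal E_c(t)\}\to1$ as $t\to\infty$. -/

import Mathlib

open MeasureTheory ProbabilityTheory Filter Topology Asymptotics

namespace WeibullPAM

/-- The `ℓ¹`-norm on `ℝ^d`. -/
noncomputable def l1 {d : ℕ} (x : Fin d → ℝ) : ℝ := ∑ i, |x i|

/-- The inclusion of the lattice `ℤ^d` into `ℝ^d`. -/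
def toReal {d : ℕ} (z : Fin d → ℤ) : Fin d → ℝ := fun i => (z i : ℝ)

/-- `ξ` is a field, indexed by `ℤ^d`, of independent random variables whose common distribution
function is the Weibull one, `P {ξ z < x} = 1 - exp (-x^γ)` for `x ≥ 0`. -/
structure IsWeibullPotential {d : ℕ} {Ω : Type*} [MeasurableSpace Ω] (P : Measure Ω) (γ : ℝ)
    (ξ : (Fin d → ℤ) → Ω → ℝ) : Prop where
  measurable : ∀ z, Measurable (ξ z)
  indep : iIndepFun ξ P
  law : ∀ z, ∀ x : ℝ, 0 ≤ x → P {ω | ξ z ω < x} = ENNReal.ofReal (1 - Real.exp (-x ^ γ))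

/-- The scale `r_t = t (log t)^(1/γ - 1) / log log t`. -/
noncomputable def rScale (γ t : ℝ) : ℝ :=
  t * Real.log t ^ (1 / γ - 1) / Real.log (Real.log t)

/-- The scale `a_t = (d log t)^(1/γ)`. -/
noncomputable def aScale (d : ℕ) (γ t : ℝ) : ℝ := (d * Real.log t) ^ (1 / γ)

/-- The scale `d_t = (d log t)^(1/γ - 1)`. -/
noncomputable def dScale (d : ℕ) (γ t : ℝ) : ℝ := (d * Real.log t) ^ (1 / γ - 1)

/-- The constant `θ = γ⁻¹ d^(1 - 1/γ)`. -/
noncomputable def theta (d : ℕ) (γ : ℝ) : ℝ := γ⁻¹ * (d : ℝ) ^ (1 - 1 / γ)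

/-- The functional `Ψ_{t,c}(z) = v z - |z| / (γ t) * log log t + c |z| / t`
for the realisation `v` of the potential. -/
noncomputable def Psi {d : ℕ} (γ : ℝ) (v : (Fin d → ℤ) → ℝ) (c t : ℝ) (z : Fin d → ℤ) : ℝ :=
  v z - l1 (toReal z) / (γ * t) * Real.log (Real.log t) + c * l1 (toReal z) / t

/-- `z` is a point where the largest value of `ψ` is attained. -/
def IsFirstMaximiser {S : Type*} (ψ : S → ℝ) (z : S) : Prop := ∀ w, ψ w ≤ ψ z

/-- `z₂` is a point of the complement of `{z₁}` where the largest value of `ψ` on that complement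
is attained. -/
def IsSecondMaximiser {S : Type*} (ψ : S → ℝ) (z₁ z₂ : S) : Prop :=
  z₂ ≠ z₁ ∧ ∀ w, w ≠ z₁ → ψ w ≤ ψ z₂

/-- `Z₁ c t` and `Z₂ c t` are random lattice points where the first and the second largest value
of `Ψ_{t,c}` are attained. Their existence is not assumed: they are only required to be maximisers
when maximisers exist, and can be arbitrary otherwise (in particular for small `t`, and
on null sets). -/
structure IsMaximiserChoice {d : ℕ} {Ω : Type*} [MeasurableSpace Ω] (P : Measure Ω) (γ : ℝ)
    (ξ : (Fin d → ℤ) → Ω → ℝ) (Z₁ Z₂ : ℝ → ℝ → Ω → (Fin d → ℤ)) : Prop where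
  aemeasurable_fst : ∀ c t, AEMeasurable (Z₁ c t) P
  aemeasurable_snd : ∀ c t, AEMeasurable (Z₂ c t) P
  fst : ∀ c, ∀ᶠ t in atTop, ∀ᵐ ω ∂P,
    (∃ z, IsFirstMaximiser (Psi γ (ξ · ω) c t) z) →
      IsFirstMaximiser (Psi γ (ξ · ω) c t) (Z₁ c t ω)
  snd : ∀ c, ∀ᶠ t in atTop, ∀ᵐ ω ∂P,
    (∃ z, IsSecondMaximiser (Psi γ (ξ · ω) c t) (Z₁ c t ω) z) →
      IsSecondMaximiser (Psi γ (ξ · ω) c t) (Z₁ c t ω) (Z₂ c t ω)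

/-- The rescaled quadruple: location of the first maximiser and its value, location of
the second maximiser and its value. -/
noncomputable def rescaled {d : ℕ} {Ω : Type*} (γ : ℝ) (ξ : (Fin d → ℤ) → Ω → ℝ)
    (Z₁ Z₂ : ℝ → ℝ → Ω → (Fin d → ℤ)) (c t : ℝ) (ω : Ω) :
    (Fin d → ℝ) × ℝ × (Fin d → ℝ) × ℝ :=
  ((rScale γ t)⁻¹ • toReal (Z₁ c t ω),
    (Psi γ (ξ · ω) c t (Z₁ c t ω) - aScale d γ (rScale γ t)) / dScale d γ (rScale γ t),
    (rScale γ t)⁻¹ • toReal (Z₂ c t ω),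
    (Psi γ (ξ · ω) c t (Z₂ c t ω) - aScale d γ (rScale γ t)) / dScale d γ (rScale γ t))

open Classical in
/-- The limit density `p(x₁, y₁, x₂, y₂)`. -/
noncomputable def limitDensity (d : ℕ) (γ : ℝ) (q : (Fin d → ℝ) × ℝ × (Fin d → ℝ) × ℝ) : ℝ :=
  let x₁ := q.1
  let y₁ := q.2.1
  let x₂ := q.2.2.1
  let y₂ := q.2.2.2
  γ ^ 2 * Real.exp (-γ * (y₁ + y₂ + theta d γ * l1 x₁ + theta d γ * l1 x₂)
      - 2 ^ d * (γ * theta d γ) ^ (-(d : ℤ)) * Real.exp (-γ * y₂))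
    * (if y₂ < y₁ then 1 else 0)

/-- The conditions on the auxiliary scaling functions: they are positive,
`f, lam, rho → 0`, `g → ∞`, the functions `1/f, g, 1/lam, 1/rho` are `o(log log t)`,
and `g rho / lam → 0`. -/
structure IsScaling (f g lam rho : ℝ → ℝ) : Prop where
  f_pos : ∀ᶠ t in atTop, 0 < f t
  g_pos : ∀ᶠ t in atTop, 0 < g t
  lam_pos : ∀ᶠ t in atTop, 0 < lam t
  rho_pos : ∀ᶠ t in atTop, 0 < rho t
  f_tendsto : Tendsto f atTop (𝓝 0)
  g_tendsto : Tendsto g atTop atTop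
  lam_tendsto : Tendsto lam atTop (𝓝 0)
  rho_tendsto : Tendsto rho atTop (𝓝 0)
  f_isLittleO : (fun t => (f t)⁻¹) =o[atTop] fun t => Real.log (Real.log t)
  g_isLittleO : g =o[atTop] fun t => Real.log (Real.log t)
  lam_isLittleO : (fun t => (lam t)⁻¹) =o[atTop] fun t => Real.log (Real.log t)
  rho_isLittleO : (fun t => (rho t)⁻¹) =o[atTop] fun t => Real.log (Real.log t)
  ratio : Tendsto (fun t => g t * rho t * (lam t)⁻¹) atTop (𝓝 0)

/-- The event `E_c(t)`. -/
def goodEvent {d : ℕ} {Ω : Type*} (γ : ℝ) (ξ : (Fin d → ℤ) → Ω → ℝ)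
    (Z₁ Z₂ : ℝ → ℝ → Ω → (Fin d → ℤ)) (f g lam : ℝ → ℝ) (c t : ℝ) : Set Ω :=
  {ω | rScale γ t * f t < l1 (toReal (Z₁ 0 t ω)) ∧
    l1 (toReal (Z₁ 0 t ω)) < rScale γ t * g t ∧
    dScale d γ t * lam t
      < Psi γ (ξ · ω) 0 t (Z₁ 0 t ω) - Psi γ (ξ · ω) 0 t (Z₂ 0 t ω) ∧
    aScale d γ (rScale γ t) - dScale d γ t * g t < Psi γ (ξ · ω) 0 t (Z₁ 0 t ω) ∧
    aScale d γ (rScale γ t) - dScale d γ t * g t < Psi γ (ξ · ω) 0 t (Z₂ 0 t ω) ∧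
    l1 (toReal (Z₁ c t ω)) < rScale γ t * g t ∧
    l1 (toReal (Z₂ c t ω)) < rScale γ t * g t}

end WeibullPAM

namespace WeibullPAM

/-! The points (rescaled position, rescaled height above the penalty) behave like a Poisson process
with intensity γ exp(-γ(y + θ|x|)). A pair of its points with heights y₁ > y₂ is the top pair
exactly when no other point lies above y₂, which has probability exp(-K exp(-γ y₂)), where K exp(-γ
y) is the mass of the intensity above height y. The product is the limit density.

The proof uses neither convergence of point processes nor tightness. The limit density has total
mass one (`lintegral_pairDensity`), so by the portmanteau theorem it suffices to show that the
liminf of the probability of each open set G is at least its limit mass. Only lower bounds are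
therefore needed. The events that (z₁, z₂) is the strict top pair with rescaled data in G are
disjoint, and on each of them the maximisers exist and are z₁, z₂; hence the probabilities of these
events may be summed (`tsum_topPairEvent_le`). Independence bounds each one below by a double
integral over the values at z₁ and z₂ of a bound for the probability that the field stays below a
cone (`lintegral_voidBound_le`). Spreading each lattice point over its cell turns the double sum
into one Lebesgue integral (`tsum_tsum_lintegral_weibull`), to which Fatou's lemma applies
(`limitLaw_le_liminf`).

Pointwise convergence of the integrand uses only the relations in `IsExtremalScale`: one expected
exceedance of level a per unit of rescaled volume, a height unit δ that changes a^γ by about γ, and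
a slope κ with rκ/δ → θ. The parameter c changes the slope by the lower order term c/t, so the limit
does not depend on it.

For the good event, the open sets `separatedPairs d n` increase to a set of full limit mass. The
same lower bound, applied for 0 and for c, shows that both rescaled quadruples lie in one of them
with probability close to one, and there the inequalities of the event hold for large t. -/

/-! ### The Weibull law -/

/-- The density of the Weibull law. -/
noncomputable def weibullDensity (γ : ℝ) : ℝ → ℝ :=
  (Set.Ioi 0).indicator fun x => γ * x ^ (γ - 1) * Real.exp (-x ^ γ)

/-- The Weibull law. -/
noncomputable def weibull (γ : ℝ) : Measure ℝ :=
  volume.withDensity fun x => ENNReal.ofReal (weibullDensity γ x)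

lemma measurable_weibullDensity (γ : ℝ) : Measurable (weibullDensity γ) := by
  unfold weibullDensity
  exact Measurable.indicator (by fun_prop) measurableSet_Ioi

lemma weibullDensity_of_pos (γ : ℝ) {x : ℝ} (hx : 0 < x) :
    weibullDensity γ x = γ * x ^ (γ - 1) * Real.exp (-x ^ γ) := by
  simp [weibullDensity, hx]

lemma weibull_Ioi {γ : ℝ} (hγ : 0 < γ) {x : ℝ} (hx : 0 ≤ x) :
    weibull γ (Set.Ioi x) = ENNReal.ofReal (Real.exp (-x ^ γ)) := by
  have hcont : ContinuousWithinAt (fun y : ℝ => -Real.exp (-y ^ γ)) (Set.Ici x) x := by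
    have : Continuous fun y : ℝ => -Real.exp (-y ^ γ) := by
      have := Real.continuous_rpow_const hγ.le
      fun_prop
    exact this.continuousWithinAt
  have hder : ∀ y ∈ Set.Ioi x, HasDerivAt (fun y : ℝ => -Real.exp (-y ^ γ))
      (γ * y ^ (γ - 1) * Real.exp (-y ^ γ)) y := by
    intro y hy
    have hy0 : y ≠ 0 := (hx.trans_lt hy).ne'
    have := ((Real.hasDerivAt_rpow_const (p := γ) (Or.inl hy0)).neg.exp).neg
    exact this.congr_deriv (by simp only [Pi.neg_apply]; ring)
  have hnn : ∀ y ∈ Set.Ioi x, 0 ≤ γ * y ^ (γ - 1) * Real.exp (-y ^ γ) := by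
    intro y hy
    have hy0 : 0 < y := hx.trans_lt hy
    positivity
  have hlim : Tendsto (fun y : ℝ => -Real.exp (-y ^ γ)) atTop (𝓝 0) := by
    have := (Real.tendsto_exp_neg_atTop_nhds_zero.comp (tendsto_rpow_atTop hγ)).neg
    simpa using this
  have hint := integrableOn_Ioi_deriv_of_nonneg hcont hder hnn hlim
  have hval := integral_Ioi_of_hasDerivAt_of_nonneg hcont hder hnn hlim
  rw [weibull, withDensity_apply _ measurableSet_Ioi,
    setLIntegral_congr_fun (g := fun y => ENNReal.ofReal (γ * y ^ (γ - 1) * Real.exp (-y ^ γ)))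
      measurableSet_Ioi]
  · rw [← ofReal_integral_eq_lintegral_ofReal hint, hval]
    · simp
    · exact (ae_restrict_iff' measurableSet_Ioi).2 (Eventually.of_forall hnn)
  · intro y hy
    simp only
    rw [weibullDensity_of_pos γ (hx.trans_lt hy)]

lemma weibull_Iic_zero (γ : ℝ) : weibull γ (Set.Iic 0) = 0 := by
  rw [weibull, withDensity_apply _ measurableSet_Iic,
    setLIntegral_congr_fun (g := fun _ => 0) measurableSet_Iic]
  · simp
  · intro y hy
    simp [weibullDensity, not_lt.2 (Set.mem_Iic.1 hy)]

lemma weibull_Ici {γ : ℝ} (hγ : 0 < γ) {x : ℝ} (hx : 0 ≤ x) :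
    weibull γ (Set.Ici x) = ENNReal.ofReal (Real.exp (-x ^ γ)) := by
  rw [← weibull_Ioi hγ hx]
  have : Set.Ioi x =ᵐ[weibull γ] Set.Ici x :=
    (withDensity_absolutelyContinuous volume _).ae_eq Ioi_ae_eq_Ici
  exact (measure_congr this).symm

lemma isProbabilityMeasure_weibull {γ : ℝ} (hγ : 0 < γ) : IsProbabilityMeasure (weibull γ) := by
  constructor
  rw [← Set.Iic_union_Ioi (a := (0 : ℝ)),
    measure_union (Set.Iic_disjoint_Ioi le_rfl) measurableSet_Ioi, weibull_Iic_zero,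
    weibull_Ioi hγ le_rfl, Real.zero_rpow hγ.ne']
  simp

namespace IsWeibullPotential

variable {d : ℕ} {Ω : Type*} [MeasurableSpace Ω] {P : Measure Ω} [IsProbabilityMeasure P] {γ : ℝ}
  {ξ : (Fin d → ℤ) → Ω → ℝ}

lemma map_eq_weibull (hξ : IsWeibullPotential P γ ξ) (hγ : 0 < γ) (z : Fin d → ℤ) :
    P.map (ξ z) = weibull γ := by
  have := isProbabilityMeasure_weibull hγ
  have : IsProbabilityMeasure (P.map (ξ z)) :=
    Measure.isProbabilityMeasure_map (hξ.measurable z).aemeasurable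
  refine Measure.ext_of_Ici _ _ fun a => ?_
  have hcompl : P.map (ξ z) (Set.Ici a) = 1 - P {ω | ξ z ω < a} := by
    rw [← Set.compl_Iio, prob_compl_eq_one_sub measurableSet_Iio,
      Measure.map_apply (hξ.measurable z) measurableSet_Iio]
    rfl
  rcases le_or_gt 0 a with ha | ha
  · rw [hcompl, hξ.law z a ha, weibull_Ici hγ ha, ← ENNReal.ofReal_one, ← ENNReal.ofReal_sub]
    · simp
    · have : Real.exp (-a ^ γ) ≤ 1 := Real.exp_le_one_iff.2 (by simpa using Real.rpow_nonneg ha γ)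
      linarith
  -- The distribution function is prescribed only on [0, ∞); its value at 0 already rules out
  -- negative values.
  · have h0 : P {ω | ξ z ω < a} = 0 := by
      refine measure_mono_null (t := {ω | ξ z ω < 0}) (fun ω hω => lt_trans hω ha) ?_
      rw [hξ.law z 0 le_rfl, Real.zero_rpow hγ.ne']
      simp
    rw [hcompl, h0, tsub_zero]
    refine (le_antisymm prob_le_one ?_).symm
    calc (1 : ENNReal) = weibull γ (Set.Ici 0) := by
          rw [weibull_Ici hγ le_rfl, Real.zero_rpow hγ.ne']; simp
      _ ≤ _ := measure_mono (Set.Ici_subset_Ici.2 ha.le)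

end IsWeibullPotential

/-! ### Lattice sums as integrals -/

/-- The lattice point indexing the cell of the rescaled lattice `r⁻¹ ℤ^d` that contains `x`. -/
noncomputable def cell {d : ℕ} (r : ℝ) (x : Fin d → ℝ) : Fin d → ℤ := fun i => ⌊r * x i⌋

lemma measurable_cell {d : ℕ} (r : ℝ) : Measurable (cell (d := d) r) := by
  unfold cell
  fun_prop

lemma volume_cell_preimage {d : ℕ} {r : ℝ} (hr : 0 < r) (z : Fin d → ℤ) :
    volume (cell r ⁻¹' {z}) = (ENNReal.ofReal (r ^ d))⁻¹ := by
  have : cell r ⁻¹' {z} = Set.univ.pi fun i => Set.Ico ((z i : ℝ) / r) ((z i + 1) / r) := by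
    ext x
    simp only [cell, Set.mem_preimage, Set.mem_singleton_iff, funext_iff, Set.mem_pi,
      Set.mem_univ, true_imp_iff, Set.mem_Ico, Int.floor_eq_iff, div_le_iff₀ hr, lt_div_iff₀ hr,
      mul_comm r]
  rw [this, Real.volume_pi_Ico]
  simp only [← sub_div, add_sub_cancel_left, Finset.prod_const, Finset.card_univ,
    Fintype.card_fin]
  rw [one_div, ENNReal.ofReal_inv_of_pos hr, ENNReal.ofReal_pow hr.le, ENNReal.inv_pow]

/-- Every cell has volume r^(-d), which the weight r^d cancels. The identity is exact, so no Riemann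
sum error has to be controlled later. -/
lemma tsum_eq_lintegral_cell {d : ℕ} {r : ℝ} (hr : 0 < r) (h : (Fin d → ℤ) → ENNReal) :
    ∑' z, h z = ∫⁻ x : Fin d → ℝ, ENNReal.ofReal (r ^ d) * h (cell r x) := by
  have hm : Measurable h := measurable_of_countable h
  have hc : Measurable fun x : Fin d → ℝ => h (cell r x) := hm.comp (measurable_cell r)
  rw [lintegral_const_mul _ hc,
    ← lintegral_map hm (measurable_cell r), lintegral_countable', ← ENNReal.tsum_mul_left]
  refine tsum_congr fun z => ?_
  have h0 : ENNReal.ofReal (r ^ d) ≠ 0 := by simpa using pow_pos hr d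
  rw [Measure.map_apply (measurable_cell r) (measurableSet_singleton z),
    volume_cell_preimage hr, mul_comm (h z), ← mul_assoc,
    ENNReal.mul_inv_cancel h0 ENNReal.ofReal_ne_top, one_mul]

lemma lintegral_eq_lintegral_affine {δ : ℝ} (hδ : 0 < δ) (b : ℝ) {h : ℝ → ENNReal}
    (hh : Measurable h) : ∫⁻ s, h s = ∫⁻ y, ENNReal.ofReal δ * h (b + δ * y) := by
  have h0 : ENNReal.ofReal δ ≠ 0 := by simpa using hδ
  rw [lintegral_const_mul _ (by fun_prop), ← lintegral_add_left_eq_self h b,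
    ← lintegral_map (f := fun y => h (b + y)) (by fun_prop)
    (measurable_const_mul δ), Real.map_volume_mul_left hδ.ne', lintegral_smul_measure,
    abs_of_pos (inv_pos.2 hδ), ENNReal.ofReal_inv_of_pos hδ, smul_eq_mul, ← mul_assoc,
    ENNReal.mul_inv_cancel h0 ENNReal.ofReal_ne_top, one_mul]

/-- The density, with respect to Lebesgue measure, of the positions and heights of the points of
the rescaled and smeared point process. -/
noncomputable def smearedDensity {d : ℕ} (γ r a δ κ : ℝ) (q : (Fin d → ℝ) × ℝ) : ℝ :=
  r ^ d * δ * weibullDensity γ (a + δ * q.2 + κ * l1 (toReal (cell r q.1)))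

lemma measurable_l1 {d : ℕ} : Measurable (l1 (d := d)) := by
  unfold l1
  fun_prop

lemma measurable_l1_cell {d : ℕ} (r : ℝ) :
    Measurable fun x : Fin d → ℝ => l1 (toReal (cell r x)) :=
  (measurable_of_countable fun z : Fin d → ℤ => l1 (toReal z)).comp (measurable_cell r)

lemma measurable_smearedDensity {d : ℕ} (γ r a δ κ : ℝ) :
    Measurable (smearedDensity (d := d) γ r a δ κ) := by
  unfold smearedDensity
  have h1 := measurable_weibullDensity γ
  have h2 : Measurable fun q : (Fin d → ℝ) × ℝ => l1 (toReal (cell r q.1)) :=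
    (measurable_l1_cell r).comp measurable_fst
  fun_prop

/-- Combines the cell identity with the substitution s = a + δy + κ|z| in the value at z. The shift
depends on z, so that y is the height above the penalty, rescaled. -/
lemma tsum_lintegral_weibull {d : ℕ} (γ a κ : ℝ) {r δ : ℝ} (hr : 0 < r) (hδ : 0 < δ)
    {F : (Fin d → ℤ) → ℝ → ENNReal} (hF : ∀ z, Measurable (F z)) :
    ∑' z, ∫⁻ s, F z s ∂weibull γ =
      ∫⁻ q : (Fin d → ℝ) × ℝ, ENNReal.ofReal (smearedDensity γ r a δ κ q) *
        F (cell r q.1) (a + δ * q.2 + κ * l1 (toReal (cell r q.1))) := by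
  have hF' : Measurable (Function.uncurry F) := measurable_from_prod_countable_right hF
  have hwd := measurable_weibullDensity γ
  have hc := measurable_cell (d := d) r
  have hl := measurable_l1_cell (d := d) r
  have hl' : Measurable fun q : (Fin d → ℝ) × ℝ => l1 (toReal (cell r q.1)) :=
    hl.comp measurable_fst
  have hFq : Measurable fun q : (Fin d → ℝ) × ℝ =>
      F (cell r q.1) (a + δ * q.2 + κ * l1 (toReal (cell r q.1))) :=
    hF'.comp (((hc.comp measurable_fst)).prodMk (by fun_prop))
  rw [tsum_eq_lintegral_cell hr, Measure.volume_eq_prod, lintegral_prod]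
  · refine lintegral_congr fun x => ?_
    rw [weibull, lintegral_withDensity_eq_lintegral_mul _ (by fun_prop) (hF _)]
    rw [lintegral_eq_lintegral_affine hδ (a + κ * l1 (toReal (cell r x)))
      (((by fun_prop : Measurable fun x => ENNReal.ofReal (weibullDensity γ x))).mul (hF _)),
      ← lintegral_const_mul]
    · refine lintegral_congr fun y => ?_
      have : a + κ * l1 (toReal (cell r x)) + δ * y = a + δ * y + κ * l1 (toReal (cell r x)) := by
        ring
      simp only [smearedDensity, Pi.mul_apply, this]
      rw [ENNReal.ofReal_mul (by positivity), ENNReal.ofReal_mul (by positivity)]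
      ring
    · have := hF (cell r x)
      exact (measurable_const.mul (Measurable.comp
        (((by fun_prop : Measurable fun x => ENNReal.ofReal (weibullDensity γ x))).mul (hF _))
        (by fun_prop)))
  · exact ((measurable_smearedDensity γ r a δ κ).ennreal_ofReal.mul hFq).aemeasurable

/-! ### The limit law -/

lemma lintegral_Ioi_of_hasDerivAt_of_nonneg {g g' : ℝ → ℝ} {a l : ℝ}
    (hder : ∀ x, HasDerivAt g (g' x) x) (hnn : ∀ x, 0 ≤ g' x) (hlim : Tendsto g atTop (𝓝 l)) :
    ∫⁻ x in Set.Ioi a, ENNReal.ofReal (g' x) = ENNReal.ofReal (l - g a) := by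
  rw [← integral_Ioi_of_hasDerivAt_of_nonneg' (fun x _ => hder x) (fun x _ => hnn x) hlim,
    ofReal_integral_eq_lintegral_ofReal
      (integrableOn_Ioi_deriv_of_nonneg' (fun x _ => hder x) (fun x _ => hnn x) hlim)
      (Eventually.of_forall hnn)]

lemma integral_exp_neg_mul_abs {b : ℝ} (hb : 0 < b) : ∫ x : ℝ, Real.exp (-b * |x|) = 2 / b := by
  rw [integral_comp_abs (f := fun x => Real.exp (-b * x)),
    integral_exp_mul_Ioi (neg_lt_zero.2 hb) 0]
  simp
  ring

lemma lintegral_exp_neg_mul_l1 {d : ℕ} {b : ℝ} (hb : 0 < b) :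
    ∫⁻ x : Fin d → ℝ, ENNReal.ofReal (Real.exp (-b * l1 x)) = ENNReal.ofReal ((2 / b) ^ d) := by
  have hint : Integrable fun x : ℝ => Real.exp (-b * |x|) := by
    -- A function that is not integrable has Bochner integral zero, whereas this integral has just
    -- been computed to be 2 / b.
    by_contra h
    have := integral_undef h
    rw [integral_exp_neg_mul_abs hb] at this
    exact (by positivity : (0 : ℝ) < 2 / b).ne' this
  have heq : (fun x : Fin d → ℝ => Real.exp (-b * l1 x)) =
      fun x => ∏ i, Real.exp (-b * |x i|) := by
    ext x
    rw [l1, Finset.mul_sum, Real.exp_sum]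
  have hint' : Integrable fun x : Fin d → ℝ => Real.exp (-b * l1 x) := by
    rw [heq]
    exact Integrable.fintype_prod (f := fun _ x => Real.exp (-b * |x|)) fun _ => hint
  rw [← ofReal_integral_eq_lintegral_ofReal hint' (Eventually.of_forall fun _ => by positivity),
    heq, integral_fintype_prod_volume_eq_pow (fun x : ℝ => Real.exp (-b * |x|)),
    integral_exp_neg_mul_abs hb, Fintype.card_fin]

/-- The intensity of the limiting Poisson point process. -/
noncomputable def intensity (d : ℕ) (γ : ℝ) (q : (Fin d → ℝ) × ℝ) : ℝ :=
  γ * Real.exp (-γ * (q.2 + theta d γ * l1 q.1))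

/-- The mass of the set of points with height in `[0, ∞)`. -/
noncomputable def massConst (d : ℕ) (γ : ℝ) : ℝ := (2 / (γ * theta d γ)) ^ d

variable {d : ℕ} {γ : ℝ}

lemma theta_pos (hd : 0 < d) (hγ : 0 < γ) : 0 < theta d γ := by
  have : (0 : ℝ) < d := by exact_mod_cast hd
  unfold theta
  positivity

lemma massConst_pos (hd : 0 < d) (hγ : 0 < γ) : 0 < massConst d γ := by
  have := theta_pos hd hγ
  unfold massConst
  positivity

lemma lintegral_exp_neg_add_theta (hd : 0 < d) (hγ : 0 < γ) (y : ℝ) :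
    ∫⁻ x : Fin d → ℝ, ENNReal.ofReal (Real.exp (-γ * (y + theta d γ * l1 x))) =
      ENNReal.ofReal (massConst d γ * Real.exp (-γ * y)) := by
  have hθ := theta_pos hd hγ
  have hm := measurable_l1 (d := d)
  have : ∀ x : Fin d → ℝ, ENNReal.ofReal (Real.exp (-γ * (y + theta d γ * l1 x))) =
      ENNReal.ofReal (Real.exp (-γ * y)) *
        ENNReal.ofReal (Real.exp (-(γ * theta d γ) * l1 x)) := fun x => by
    rw [← ENNReal.ofReal_mul (by positivity), ← Real.exp_add]
    ring_nf
  simp_rw [this]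
  rw [lintegral_const_mul _ (by fun_prop), lintegral_exp_neg_mul_l1 (by positivity),
    ← ENNReal.ofReal_mul (by positivity), mul_comm]
  rfl

lemma measurable_intensity : Measurable (intensity d γ) := by
  have : Measurable fun q : (Fin d → ℝ) × ℝ => l1 q.1 := measurable_l1.comp measurable_fst
  unfold intensity
  fun_prop

lemma lintegral_intensity_above (hd : 0 < d) (hγ : 0 < γ) (y : ℝ) :
    ∫⁻ q : (Fin d → ℝ) × ℝ, {q | y < q.2}.indicator
      (fun q => ENNReal.ofReal (intensity d γ q)) q =
      ENNReal.ofReal (massConst d γ * Real.exp (-γ * y)) := by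
  rw [Measure.volume_eq_prod, lintegral_prod, ← lintegral_exp_neg_add_theta hd hγ y]
  · refine lintegral_congr fun x => ?_
    have hder : ∀ s, HasDerivAt (fun s => -Real.exp (-γ * (s + theta d γ * l1 x)))
        (intensity d γ (x, s)) s := fun s => by
      have := ((((hasDerivAt_id s).add_const (theta d γ * l1 x)).const_mul (-γ)).exp).neg
      refine this.congr_deriv ?_
      simp only [intensity, id]
      ring
    have hlim : Tendsto (fun s => -Real.exp (-γ * (s + theta d γ * l1 x))) atTop (𝓝 0) := by
      rw [← neg_zero]
      refine (Real.tendsto_exp_atBot.comp ?_).neg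
      exact (tendsto_atTop_add_const_right _ _ tendsto_id).const_mul_atTop_of_neg
        (neg_lt_zero.2 hγ)
    have := lintegral_Ioi_of_hasDerivAt_of_nonneg (a := y) hder
      (fun s => by unfold intensity; positivity) hlim
    rw [← lintegral_indicator measurableSet_Ioi, zero_sub, neg_neg] at this
    rw [← this]
    rfl
  · exact ((measurable_intensity.ennreal_ofReal).indicator
      (measurableSet_lt measurable_const measurable_snd)).aemeasurable

/-- The limit density as a function of a pair of points. -/
noncomputable def pairDensity (d : ℕ) (γ : ℝ) (w : ((Fin d → ℝ) × ℝ) × ((Fin d → ℝ) × ℝ)) :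
    ENNReal :=
  ENNReal.ofReal (intensity d γ w.2) *
    ENNReal.ofReal (Real.exp (-(massConst d γ * Real.exp (-γ * w.2.2)))) *
    {q : (Fin d → ℝ) × ℝ | w.2.2 < q.2}.indicator (fun q => ENNReal.ofReal (intensity d γ q)) w.1

lemma measurable_pairDensity : Measurable (pairDensity d γ) := by
  have h := measurable_intensity (d := d) (γ := γ)
  have h1 : Measurable fun w : ((Fin d → ℝ) × ℝ) × ((Fin d → ℝ) × ℝ) =>
      {w : ((Fin d → ℝ) × ℝ) × ((Fin d → ℝ) × ℝ) | w.2.2 < w.1.2}.indicator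
        (fun w => ENNReal.ofReal (intensity d γ w.1)) w :=
    Measurable.indicator (by fun_prop) (measurableSet_lt (by fun_prop) (by fun_prop))
  unfold pairDensity
  refine Measurable.mul (by fun_prop) h1

lemma ofReal_limitDensity (hγ : 0 < γ) (w : ((Fin d → ℝ) × ℝ) × ((Fin d → ℝ) × ℝ)) :
    ENNReal.ofReal (limitDensity d γ (MeasurableEquiv.prodAssoc w)) = pairDensity d γ w := by
  obtain ⟨⟨x₁, y₁⟩, ⟨x₂, y₂⟩⟩ := w
  have hK : (2 : ℝ) ^ d * (γ * theta d γ) ^ (-(d : ℤ)) = massConst d γ := by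
    rw [massConst, div_pow, zpow_neg, zpow_natCast]
    rfl
  change ENNReal.ofReal (limitDensity d γ (x₁, y₁, x₂, y₂)) = _
  simp only [limitDensity, pairDensity, hK]
  by_cases h : y₂ < y₁
  · rw [Set.indicator_of_mem (by exact h), if_pos h, mul_one,
      ← ENNReal.ofReal_mul (by unfold intensity; positivity),
      ← ENNReal.ofReal_mul (by unfold intensity; positivity)]
    congr 1
    rw [sub_eq_add_neg, Real.exp_add]
    simp only [intensity]
    have : Real.exp (-γ * (y₁ + y₂ + theta d γ * l1 x₁ + theta d γ * l1 x₂)) =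
        Real.exp (-γ * (y₁ + theta d γ * l1 x₁)) * Real.exp (-γ * (y₂ + theta d γ * l1 x₂)) := by
      rw [← Real.exp_add]
      ring_nf
    rw [this]
    ring
  · rw [Set.indicator_of_notMem (by exact h), if_neg h]
    simp

/-- With u = K exp(-γy) this is the integral of u exp(-u) over (0, ∞); the antiderivative in y is (1
+ u) exp(-u). -/
lemma lintegral_gumbel (hγ : 0 < γ) {K : ℝ} (hK : 0 < K) :
    ∫⁻ y, ENNReal.ofReal (γ * (K * Real.exp (-γ * y)) ^ 2 *
      Real.exp (-(K * Real.exp (-γ * y)))) = 1 := by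
  set g : ℝ → ℝ := fun y => (1 + K * Real.exp (-γ * y)) * Real.exp (-(K * Real.exp (-γ * y)))
    with hg
  have hder : ∀ y, HasDerivAt g (γ * (K * Real.exp (-γ * y)) ^ 2 *
      Real.exp (-(K * Real.exp (-γ * y)))) y := fun y => by
    have hu := (((hasDerivAt_id y).const_mul (-γ)).exp).const_mul K
    refine ((hu.const_add 1).mul hu.neg.exp).congr_deriv ?_
    simp only [id, Pi.neg_apply]
    ring
  have hu : Tendsto (fun y => K * Real.exp (-γ * y)) atTop (𝓝 0) := by
    have : Tendsto (fun y => Real.exp (-γ * y)) atTop (𝓝 0) :=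
      Real.tendsto_exp_atBot.comp (tendsto_id.const_mul_atTop_of_neg (neg_lt_zero.2 hγ))
    simpa using this.const_mul K
  have hlim : Tendsto g atTop (𝓝 1) := by
    have := (hu.const_add 1).mul ((Real.continuous_exp.tendsto _).comp hu.neg)
    simpa [hg] using this
  have hbot : Tendsto (fun c : ℝ => g (-c)) atTop (𝓝 0) := by
    have hu' : Tendsto (fun c : ℝ => K * Real.exp (-γ * -c)) atTop atTop := by
      refine Tendsto.const_mul_atTop hK (Real.tendsto_exp_atTop.comp ?_)
      simpa using tendsto_id.const_mul_atTop hγ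
    have h1 : Tendsto (fun u : ℝ => (1 + u) * Real.exp (-u)) atTop (𝓝 0) := by
      have h2 := Real.tendsto_pow_mul_exp_neg_atTop_nhds_zero 1
      have h3 := Real.tendsto_exp_neg_atTop_nhds_zero
      simpa [add_mul] using h3.add h2
    exact h1.comp hu'
  have hcover : AECover (volume : Measure ℝ) atTop fun c : ℝ => Set.Ioi (-c) :=
    aecover_Ioi tendsto_neg_atTop_atBot
  refine hcover.lintegral_eq_of_tendsto 1 (by fun_prop) ?_
  simp_rw [lintegral_Ioi_of_hasDerivAt_of_nonneg hder (fun y => by positivity) hlim]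
  have := ENNReal.tendsto_ofReal (hbot.const_sub 1)
  simpa using this

/-- Integrating out the higher point and then the position of the lower one leaves the density of
the second largest height, treated by `lintegral_gumbel`. Total mass one is what lets lower bounds
on open sets identify the limit. -/
lemma lintegral_pairDensity (hd : 0 < d) (hγ : 0 < γ) : ∫⁻ w, pairDensity d γ w = 1 := by
  have hK := massConst_pos hd hγ
  have hθ := theta_pos hd hγ
  have hl := measurable_l1 (d := d)
  have hi := measurable_intensity (d := d) (γ := γ)
  rw [Measure.volume_eq_prod, lintegral_prod_symm _ measurable_pairDensity.aemeasurable]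
  have h1 : ∀ q : (Fin d → ℝ) × ℝ, ∫⁻ q₁, pairDensity d γ (q₁, q) =
      ENNReal.ofReal (intensity d γ q) *
        ENNReal.ofReal (Real.exp (-(massConst d γ * Real.exp (-γ * q.2)))) *
        ENNReal.ofReal (massConst d γ * Real.exp (-γ * q.2)) := fun q => by
    rw [← lintegral_intensity_above hd hγ q.2, ← lintegral_const_mul]
    · rfl
    · exact (hi.ennreal_ofReal).indicator (measurableSet_lt measurable_const measurable_snd)
  simp_rw [h1]
  rw [Measure.volume_eq_prod, lintegral_prod_symm _ (by fun_prop), ← lintegral_gumbel hγ hK]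
  refine lintegral_congr fun y => ?_
  have h2 : ∀ x : Fin d → ℝ, ENNReal.ofReal (intensity d γ (x, y)) *
        ENNReal.ofReal (Real.exp (-(massConst d γ * Real.exp (-γ * y)))) *
        ENNReal.ofReal (massConst d γ * Real.exp (-γ * y)) =
      ENNReal.ofReal (γ * Real.exp (-(massConst d γ * Real.exp (-γ * y))) *
        (massConst d γ * Real.exp (-γ * y))) *
        ENNReal.ofReal (Real.exp (-γ * (y + theta d γ * l1 x))) := fun x => by
    rw [← ENNReal.ofReal_mul (by unfold intensity; positivity),
      ← ENNReal.ofReal_mul (by unfold intensity; positivity),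
      ← ENNReal.ofReal_mul (by positivity)]
    simp only [intensity]
    congr 1
    ring
  simp_rw [h2]
  rw [lintegral_const_mul _ (by fun_prop), lintegral_exp_neg_add_theta hd hγ,
    ← ENNReal.ofReal_mul (by positivity)]
  congr 1
  ring

/-- The limit law. -/
noncomputable def limitLaw (d : ℕ) (γ : ℝ) : Measure ((Fin d → ℝ) × ℝ × (Fin d → ℝ) × ℝ) :=
  volume.withDensity fun q => ENNReal.ofReal (limitDensity d γ q)

lemma limitLaw_apply (hγ : 0 < γ) {G : Set ((Fin d → ℝ) × ℝ × (Fin d → ℝ) × ℝ)}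
    (hG : MeasurableSet G) :
    limitLaw d γ G = ∫⁻ w, (MeasurableEquiv.prodAssoc ⁻¹' G).indicator (pairDensity d γ) w := by
  have hp := volume_preserving_prodAssoc (α₁ := Fin d → ℝ) (β₁ := ℝ) (γ₁ := (Fin d → ℝ) × ℝ)
  rw [limitLaw, withDensity_apply _ hG, ← lintegral_indicator hG,
    ← hp.lintegral_comp_emb MeasurableEquiv.prodAssoc.measurableEmbedding]
  refine lintegral_congr fun w => ?_
  by_cases h : MeasurableEquiv.prodAssoc w ∈ G
  · rw [Set.indicator_of_mem h, Set.indicator_of_mem (by exact h), ofReal_limitDensity hγ]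
  · rw [Set.indicator_of_notMem h, Set.indicator_of_notMem (by exact h)]

lemma isProbabilityMeasure_limitLaw (hd : 0 < d) (hγ : 0 < γ) :
    IsProbabilityMeasure (limitLaw d γ) := by
  constructor
  rw [limitLaw_apply hγ MeasurableSet.univ, Set.preimage_univ, Set.indicator_univ]
  exact lintegral_pairDensity hd hγ

/-! ### Independence bounds -/

/-- From 1/(1 - p) = 1 + p/(1 - p) ≤ exp(p/(1 - p)). The common bound q makes the exponent linear in
p, so that products over sites become sums. -/
lemma exp_neg_div_le_one_sub {p q : ℝ} (hp : 0 ≤ p) (hpq : p ≤ q) (hq : q < 1) :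
    Real.exp (-(p / (1 - q))) ≤ 1 - p := by
  have h1 : 0 < 1 - q := by linarith
  have h2 : 0 < 1 - p := by linarith
  have h3 : p / (1 - p) ≤ p / (1 - q) := by gcongr
  have h4 : (1 - p)⁻¹ = p / (1 - p) + 1 := by field_simp; ring
  rw [Real.exp_neg]
  refine inv_le_of_inv_le₀ h2 ?_
  rw [h4]
  exact (Real.add_one_le_exp _).trans (Real.exp_le_exp.2 h3)

/-- The expected number of points of the field lying above the cone `v + κ |z|`. -/
noncomputable def exceedanceMean (d : ℕ) (γ κ v : ℝ) : ENNReal :=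
  ∑' z : Fin d → ℤ, ENNReal.ofReal (Real.exp (-(v + κ * l1 (toReal z)) ^ γ))

open Classical in
/-- A lower bound for the probability that the field lies below the cone `v + κ |z|`. -/
noncomputable def voidBound (d : ℕ) (γ κ v : ℝ) : ENNReal :=
  if 0 < v ∧ exceedanceMean d γ κ v ≠ ⊤ then
    ENNReal.ofReal (Real.exp (-((exceedanceMean d γ κ v).toReal / (1 - Real.exp (-v ^ γ)))))
  -- The value 0 keeps the lower bound valid for every v; along the extremal scales the first branch
  -- eventually applies.
  else 0

lemma measurable_exceedanceMean (d : ℕ) (γ κ : ℝ) : Measurable (exceedanceMean d γ κ) := by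
  unfold exceedanceMean
  exact Measurable.tsum fun z => by fun_prop

lemma measurable_voidBound (d : ℕ) (γ κ : ℝ) : Measurable (voidBound d γ κ) := by
  have h := measurable_exceedanceMean d γ κ
  unfold voidBound
  refine Measurable.ite ?_ (by fun_prop) measurable_const
  exact measurableSet_Ioi.inter (h (measurableSet_singleton ⊤).compl)

lemma l1_nonneg {d : ℕ} (x : Fin d → ℝ) : 0 ≤ l1 x := Finset.sum_nonneg fun _ _ => abs_nonneg _

namespace IsWeibullPotential

variable {d : ℕ} {Ω : Type*} [MeasurableSpace Ω] {P : Measure Ω} {γ : ℝ}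
  {ξ : (Fin d → ℤ) → Ω → ℝ}

/-- For finitely many sites the probability is a product, estimated by `exp_neg_div_le_one_sub` with
q the tail at the vertex of the cone. Continuity from above along finite sets extends the bound to
the whole lattice. -/
lemma voidBound_le [IsProbabilityMeasure P] (hξ : IsWeibullPotential P γ ξ) (hγ : 0 < γ)
    {κ : ℝ} (hκ : 0 ≤ κ) (v : ℝ) :
    voidBound d γ κ v ≤ P {ω | ∀ z, ξ z ω < v + κ * l1 (toReal z)} := by
  unfold voidBound
  split_ifs with h
  swap
  · exact zero_le
  obtain ⟨hv, htop⟩ := h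
  set p : (Fin d → ℤ) → ℝ := fun z => Real.exp (-(v + κ * l1 (toReal z)) ^ γ) with hp
  set q : ℝ := Real.exp (-v ^ γ) with hq
  have hq1 : q < 1 := Real.exp_lt_one_iff.2 (neg_lt_zero.2 (Real.rpow_pos_of_pos hv γ))
  have hk : ∀ z : Fin d → ℤ, 0 ≤ κ * l1 (toReal z) := fun z => mul_nonneg hκ (l1_nonneg _)
  have hpq : ∀ z, p z ≤ q := fun z => by
    have := hk z
    refine Real.exp_le_exp.2 (neg_le_neg ?_)
    exact Real.rpow_le_rpow hv.le (by linarith) hγ.le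
  set A : Finset (Fin d → ℤ) → Set Ω :=
    fun S => ⋂ z ∈ S, ξ z ⁻¹' Set.Iio (v + κ * l1 (toReal z)) with hA
  have hAm : ∀ S, MeasurableSet (A S) := fun S =>
    Finset.measurableSet_biInter S fun z _ => hξ.measurable z measurableSet_Iio
  have hAanti : Antitone A := fun S T hST => Set.biInter_subset_biInter_left hST
  have hAeq : {ω | ∀ z, ξ z ω < v + κ * l1 (toReal z)} = ⋂ S, A S := by
    ext ω
    simp only [hA, Set.mem_ofPred_eq, Set.mem_iInter, Set.mem_preimage, Set.mem_Iio]
    exact ⟨fun h S z _ => h z, fun h z => h {z} z (Finset.mem_singleton_self z)⟩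
  have hlim := tendsto_measure_iInter_atTop (μ := P) (fun S => (hAm S).nullMeasurableSet) hAanti
    ⟨∅, measure_ne_top _ _⟩
  rw [hAeq]
  refine ge_of_tendsto hlim (Eventually.of_forall fun S => ?_)
  have hprod : P (A S) = ∏ z ∈ S, ENNReal.ofReal (1 - p z) := by
    rw [hA, hξ.indep.measure_inter_preimage_eq_mul S fun z _ => measurableSet_Iio]
    refine Finset.prod_congr rfl fun z _ => ?_
    exact hξ.law z _ (by have := hk z; linarith)
  simp only [Function.comp]
  rw [hprod, ← ENNReal.ofReal_prod_of_nonneg fun z _ => by linarith [hpq z]]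
  refine ENNReal.ofReal_le_ofReal ?_
  have hsum : ∑ z ∈ S, p z ≤ (exceedanceMean d γ κ v).toReal := by
    rw [← ENNReal.ofReal_le_iff_le_toReal htop, ENNReal.ofReal_sum_of_nonneg
      fun z _ => (Real.exp_pos _).le]
    exact ENNReal.sum_le_tsum S
  calc Real.exp (-((exceedanceMean d γ κ v).toReal / (1 - q)))
      ≤ Real.exp (∑ z ∈ S, -(p z / (1 - q))) := by
        rw [Real.exp_le_exp, Finset.sum_neg_distrib, neg_le_neg_iff, ← Finset.sum_div]
        have : 0 < 1 - q := by linarith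
        gcongr
    _ = ∏ z ∈ S, Real.exp (-(p z / (1 - q))) := Real.exp_sum _ _
    _ ≤ ∏ z ∈ S, (1 - p z) := Finset.prod_le_prod (fun z _ => (Real.exp_pos _).le)
        fun z _ => exp_neg_div_le_one_sub (Real.exp_pos _).le (hpq z) hq1

lemma indepFun_pair_compl (hξ : IsWeibullPotential P γ ξ) (z₁ z₂ : Fin d → ℤ) :
    IndepFun (fun ω => (ξ z₁ ω, ξ z₂ ω))
      (fun ω (z : ({z₁, z₂}ᶜ : Set (Fin d → ℤ))) => ξ z ω) P := by
  set m : (Fin d → ℤ) → MeasurableSpace Ω :=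
    fun z => MeasurableSpace.comap (ξ z) inferInstance with hm
  have hind := indep_iSup_of_disjoint (m := m) (fun z => (hξ.measurable z).comap_le)
    hξ.indep (disjoint_compl_right (a := ({z₁, z₂} : Set (Fin d → ℤ))))
  have hmem : ∀ (S : Set (Fin d → ℤ)) z, z ∈ S → Measurable[⨆ z ∈ S, m z] (ξ z) := fun S z hz =>
    (comap_measurable (ξ z)).mono (le_iSup₂ (f := fun z (_ : z ∈ S) => m z) z hz) le_rfl
  refine indep_of_indep_of_le_left (indep_of_indep_of_le_right hind ?_) ?_
  · refine Measurable.comap_le ?_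
    exact @measurable_pi_lambda _ _ _ (⨆ z ∈ ({z₁, z₂}ᶜ : Set (Fin d → ℤ)), m z) _ _
      fun z => hmem _ z z.2
  · refine Measurable.comap_le ?_
    exact (hmem _ z₁ (by simp)).prodMk (hmem _ z₂ (by simp))

/-- Condition on the two values: the remaining field is independent of them and has to lie below the
cone whose vertex is the height of the second point. -/
lemma lintegral_voidBound_le [IsProbabilityMeasure P]
    (hξ : IsWeibullPotential P γ ξ) (hγ : 0 < γ) {κ : ℝ} (hκ : 0 ≤ κ)
    {z₁ z₂ : Fin d → ℤ} (hz : z₁ ≠ z₂) {S : Set (ℝ × ℝ)} (hS : MeasurableSet S) :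
    ∫⁻ s₁, ∫⁻ s₂, S.indicator (fun s => voidBound d γ κ (s.2 - κ * l1 (toReal z₂))) (s₁, s₂)
        ∂weibull γ ∂weibull γ ≤
      P {ω | (ξ z₁ ω, ξ z₂ ω) ∈ S ∧ ∀ z, z ≠ z₁ → z ≠ z₂ →
        ξ z ω - κ * l1 (toReal z) < ξ z₂ ω - κ * l1 (toReal z₂)} := by
  have := isProbabilityMeasure_weibull hγ
  set T : Set (Fin d → ℤ) := {z₁, z₂}ᶜ with hT
  set X : Ω → ℝ × ℝ := fun ω => (ξ z₁ ω, ξ z₂ ω) with hX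
  set R : Ω → T → ℝ := fun ω z => ξ z ω with hR
  have hXm : Measurable X := (hξ.measurable z₁).prodMk (hξ.measurable z₂)
  have hRm : Measurable R := measurable_pi_lambda _ fun z => hξ.measurable z
  have hXlaw : P.map X = (weibull γ).prod (weibull γ) := by
    rw [(indepFun_iff_map_prod_eq_prod_map_map (hξ.measurable z₁).aemeasurable
      (hξ.measurable z₂).aemeasurable).1 (hξ.indep.indepFun hz), hξ.map_eq_weibull hγ,
      hξ.map_eq_weibull hγ]
  have hlaw : P.map (fun ω => (X ω, R ω)) = ((weibull γ).prod (weibull γ)).prod (P.map R) := by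
    rw [(indepFun_iff_map_prod_eq_prod_map_map hXm.aemeasurable hRm.aemeasurable).1
      (hξ.indepFun_pair_compl z₁ z₂), hXlaw]
  set B : Set ((ℝ × ℝ) × (T → ℝ)) := {w | w.1 ∈ S ∧ ∀ z : T,
    w.2 z - κ * l1 (toReal (z : Fin d → ℤ)) < w.1.2 - κ * l1 (toReal z₂)} with hB
  have hBm : MeasurableSet B := by
    refine (measurable_fst hS).inter ?_
    have : {w : (ℝ × ℝ) × (T → ℝ) | ∀ z : T,
        w.2 z - κ * l1 (toReal (z : Fin d → ℤ)) < w.1.2 - κ * l1 (toReal z₂)} =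
        ⋂ z : T, {w | w.2 z - κ * l1 (toReal (z : Fin d → ℤ)) <
          w.1.2 - κ * l1 (toReal z₂)} := by
      ext w
      simp
    change MeasurableSet {w : (ℝ × ℝ) × (T → ℝ) | ∀ z : T,
        w.2 z - κ * l1 (toReal (z : Fin d → ℤ)) < w.1.2 - κ * l1 (toReal z₂)}
    rw [this]
    exact MeasurableSet.iInter fun z => measurableSet_lt (by fun_prop) (by fun_prop)
  have hset : {ω | (ξ z₁ ω, ξ z₂ ω) ∈ S ∧ ∀ z, z ≠ z₁ → z ≠ z₂ →
      ξ z ω - κ * l1 (toReal z) < ξ z₂ ω - κ * l1 (toReal z₂)} =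
      (fun ω => (X ω, R ω)) ⁻¹' B := by
    ext ω
    simp [hB, hX, hR, hT]
  have hRp : IsProbabilityMeasure (P.map R) := Measure.isProbabilityMeasure_map hRm.aemeasurable
  have hvm : Measurable fun s : ℝ × ℝ => voidBound d γ κ (s.2 - κ * l1 (toReal z₂)) :=
    (measurable_voidBound d γ κ).comp (by fun_prop)
  rw [hset, ← Measure.map_apply (hXm.prodMk hRm) hBm, hlaw, Measure.prod_apply hBm,
    ← lintegral_prod (μ := weibull γ) (ν := weibull γ)
      (S.indicator fun s => voidBound d γ κ (s.2 - κ * l1 (toReal z₂)))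
      (hvm.indicator hS).aemeasurable]
  refine lintegral_mono fun s => ?_
  by_cases hs : s ∈ S
  swap
  · simp [Set.indicator_of_notMem hs]
  rw [Set.indicator_of_mem hs]
  -- The void event also constrains the sites z₁ and z₂; dropping these constraints only enlarges
  -- the event.
  refine (hξ.voidBound_le hγ hκ _).trans ?_
  rw [Measure.map_apply hRm (measurable_prodMk_left hBm)]
  refine measure_mono fun ω hω => ⟨hs, fun z => ?_⟩
  have := hω z
  simp only [hR]
  linarith

end IsWeibullPotential

/-! ### Asymptotics of the rescaled intensity -/

/-- The scales `r`, `a`, `δ` and the slope `κ` produce, in the limit, the Poisson point process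
with intensity `intensity d γ`. -/
structure IsExtremalScale {ι : Type*} (d : ℕ) (γ : ℝ) (l : Filter ι) (r a δ κ : ι → ℝ) :
    Prop where
  r_tendsto : Tendsto r l atTop
  a_tendsto : Tendsto a l atTop
  δ_pos : ∀ᶠ i in l, 0 < δ i
  pow_mul_exp : ∀ᶠ i in l, r i ^ d * Real.exp (-a i ^ γ) = 1
  mul_rpow : ∀ᶠ i in l, δ i * a i ^ (γ - 1) = 1
  slope_tendsto : Tendsto (fun i => r i * κ i / δ i) l (𝓝 (theta d γ))

lemma abs_l1_cell_sub_le {d : ℕ} {r : ℝ} (hr : 0 ≤ r) (x : Fin d → ℝ) :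
    |l1 (toReal (cell r x)) - r * l1 x| ≤ d := by
  rw [l1, l1, Finset.mul_sum, ← Finset.sum_sub_distrib]
  calc |∑ i, (|toReal (cell r x) i| - r * |x i|)|
      ≤ ∑ i, |(|toReal (cell r x) i| - r * |x i|)| := Finset.abs_sum_le_sum_abs _ _
    _ ≤ ∑ _i : Fin d, (1 : ℝ) := Finset.sum_le_sum fun i _ => by
        have h : r * |x i| = |r * x i| := by rw [abs_mul, abs_of_nonneg hr]
        rw [h]
        refine (abs_abs_sub_abs_le _ _).trans ?_
        change |(⌊r * x i⌋ : ℝ) - r * x i| ≤ 1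
        rw [abs_le]
        have := Int.floor_le (r * x i)
        have := Int.lt_floor_add_one (r * x i)
        constructor <;> linarith
    _ = d := by simp

lemma tendsto_l1_cell_div {ι : Type*} {d : ℕ} {l : Filter ι} {r : ι → ℝ}
    (hr : Tendsto r l atTop) (x : Fin d → ℝ) :
    Tendsto (fun i => l1 (toReal (cell (r i) x)) / r i) l (𝓝 (l1 x)) := by
  rw [tendsto_iff_norm_sub_tendsto_zero]
  refine squeeze_zero' (Eventually.of_forall fun _ => norm_nonneg _) ?_
    (tendsto_const_nhds (x := (d : ℝ)) |>.div_atTop hr)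
  filter_upwards [hr.eventually_gt_atTop 0] with i hi
  have h : l1 (toReal (cell (r i) x)) / r i - l1 x =
      (l1 (toReal (cell (r i) x)) - r i * l1 x) / r i := by field_simp
  rw [Real.norm_eq_abs, h, abs_div, abs_of_pos hi]
  gcongr
  exact abs_l1_cell_sub_le hi.le x

lemma tendsto_cell_div {ι : Type*} {d : ℕ} {l : Filter ι} {r : ι → ℝ}
    (hr : Tendsto r l atTop) (x : Fin d → ℝ) :
    Tendsto (fun i => (r i)⁻¹ • toReal (cell (r i) x)) l (𝓝 x) := by
  rw [tendsto_pi_nhds]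
  intro j
  rw [tendsto_iff_norm_sub_tendsto_zero]
  refine squeeze_zero' (Eventually.of_forall fun _ => norm_nonneg _) ?_
    (tendsto_const_nhds (x := (1 : ℝ)) |>.div_atTop hr)
  filter_upwards [hr.eventually_gt_atTop 0] with i hi
  have h : ((r i)⁻¹ • toReal (cell (r i) x)) j - x j = ((⌊r i * x j⌋ : ℝ) - r i * x j) / r i := by
    simp only [Pi.smul_apply, toReal, cell, smul_eq_mul]
    field_simp
  rw [Real.norm_eq_abs, h, abs_div, abs_of_pos hi]
  gcongr
  rw [abs_le]
  have := Int.floor_le (r i * x j)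
  have := Int.lt_floor_add_one (r i * x j)
  constructor <;> linarith

/-- A lower bound for the increments of the power function, uniform in the scale `M`. -/
lemma one_add_rpow_min_le {γ M w : ℝ} (hγ : 0 < γ) (hM : 1 ≤ M) (hw : 0 ≤ w) :
    (1 + w) ^ min γ 1 - 1 ≤ M * ((1 + w / M) ^ γ - 1) := by
  have hM0 : 0 < M := by linarith
  have hm0 : 0 ≤ min γ 1 := le_min hγ.le zero_le_one
  -- 1 + w/M is the convex combination of 1 + w and 1 with weights 1/M and 1 - 1/M. The exponent min
  -- γ 1 makes the power concave, and it may be raised to γ since the base is at least 1.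
  have hconc := (Real.concaveOn_rpow hm0 (min_le_right γ 1)).2
    (show (1 + w) ∈ Set.Ici (0 : ℝ) from by simp; linarith)
    (show (1 : ℝ) ∈ Set.Ici (0 : ℝ) from by simp)
    (show 0 ≤ M⁻¹ by positivity) (show 0 ≤ 1 - M⁻¹ by
      have := inv_le_one_of_one_le₀ hM
      linarith) (by ring)
  simp only [smul_eq_mul, Real.one_rpow, mul_one] at hconc
  have h1 : M⁻¹ * (1 + w) + (1 - M⁻¹) = 1 + w / M := by field_simp; ring
  rw [h1] at hconc
  have h2 : (1 + w / M) ^ min γ 1 ≤ (1 + w / M) ^ γ :=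
    Real.rpow_le_rpow_of_exponent_le (by have : 0 ≤ w / M := by positivity
                                         linarith) (min_le_left γ 1)
  have h3 := mul_le_mul_of_nonneg_left (hconc.trans h2) hM0.le
  have h4 : M * (M⁻¹ * (1 + w) ^ min γ 1 + (1 - M⁻¹)) = (1 + w) ^ min γ 1 + M - 1 := by
    field_simp
    ring
  rw [h4] at h3
  linarith

/-- Keeps one term of the exponential series, trading stretched exponential decay for polynomial
decay of arbitrary order. -/
lemma exp_neg_rpow_le {m U : ℝ} (hU : 0 < U) (k : ℕ) :
    Real.exp (-U ^ m) ≤ k.factorial * U ^ (-(m * k)) := by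
  have hUm : 0 < U ^ m := Real.rpow_pos_of_pos hU m
  have h := Real.pow_div_factorial_le_exp (U ^ m) hUm.le k
  rw [Real.exp_neg, Real.rpow_neg hU.le, Real.rpow_mul hU.le, Real.rpow_natCast]
  have hk : (0 : ℝ) < k.factorial := by exact_mod_cast k.factorial_pos
  rw [inv_le_comm₀ (Real.exp_pos _) (by positivity), mul_inv, inv_inv]
  rwa [mul_comm, ← div_eq_mul_inv]

lemma norm_le_l1 {d : ℕ} (x : Fin d → ℝ) : ‖x‖ ≤ l1 x :=
  (pi_norm_le_iff_of_nonneg (l1_nonneg x)).2 fun i =>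
    Finset.single_le_sum (f := fun i => |x i|) (fun _ _ => abs_nonneg _) (Finset.mem_univ i)

/-- One constant serves both s ≤ D and s ≥ D. Here D allows for the rounding of positions to lattice
points. -/
lemma min_div_mul_le {β D s : ℝ} (hβ : 0 < β) (hD : 0 ≤ D) :
    min β 1 / (1 + D) * (1 + s) ≤ 1 + β * max (s - D) 0 := by
  have hc0 : 0 < min β 1 := lt_min hβ one_pos
  have hc1 : min β 1 / (1 + D) * (1 + D) ≤ 1 := by
    rw [div_mul_cancel₀ _ (by linarith)]
    exact min_le_right _ _
  have hc2 : min β 1 / (1 + D) ≤ β :=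
    (div_le_self hc0.le (by linarith)).trans (min_le_left _ _)
  have hc : 0 < min β 1 / (1 + D) := by positivity
  rcases le_total s D with h | h
  · rw [max_eq_right (by linarith)]
    have := mul_le_mul_of_nonneg_left (by linarith : 1 + s ≤ 1 + D) hc.le
    linarith
  · rw [max_eq_left (by linarith)]
    have := mul_le_mul_of_nonneg_right hc2 (by linarith : 0 ≤ s - D)
    nlinarith

namespace IsExtremalScale

variable {ι : Type*} {d : ℕ} {γ : ℝ} {l : Filter ι} {r a δ κ : ι → ℝ}

lemma tendsto_rpow (h : IsExtremalScale d γ l r a δ κ) (hγ : 0 < γ) :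
    Tendsto (fun i => a i ^ γ) l atTop := (tendsto_rpow_atTop hγ).comp h.a_tendsto

/-- `δ = a / a ^ γ`. -/
lemma δ_eq (h : IsExtremalScale d γ l r a δ κ) : ∀ᶠ i in l, δ i = a i * (a i ^ γ)⁻¹ := by
  filter_upwards [h.mul_rpow, h.a_tendsto.eventually_gt_atTop 0] with i hi ha
  rw [Real.rpow_sub_one ha.ne'] at hi
  have : a i ^ γ ≠ 0 := (Real.rpow_pos_of_pos ha γ).ne'
  field_simp at hi ⊢
  linarith

lemma tendsto_div_rpow (h : IsExtremalScale d γ l r a δ κ) (hγ : 0 < γ) {w : ι → ℝ} {w₀ : ℝ}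
    (hw : Tendsto w l (𝓝 w₀)) : Tendsto (fun i => (a i ^ γ)⁻¹ * w i) l (𝓝 0) := by
  simpa using (h.tendsto_rpow hγ).inv_tendsto_atTop.mul hw

lemma add_mul_eq (h : IsExtremalScale d γ l r a δ κ) (w : ι → ℝ) :
    ∀ᶠ i in l, a i + δ i * w i = a i * (1 + (a i ^ γ)⁻¹ * w i) := by
  filter_upwards [h.δ_eq] with i hi
  rw [hi]
  ring

lemma one_add_pos (h : IsExtremalScale d γ l r a δ κ) (hγ : 0 < γ) {w : ι → ℝ} {w₀ : ℝ}
    (hw : Tendsto w l (𝓝 w₀)) : ∀ᶠ i in l, 0 < 1 + (a i ^ γ)⁻¹ * w i := by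
  have := (h.tendsto_div_rpow hγ hw).const_add 1
  rw [add_zero] at this
  exact this.eventually (lt_mem_nhds one_pos)

lemma add_mul_tendsto (h : IsExtremalScale d γ l r a δ κ) (hγ : 0 < γ) {w : ι → ℝ} {w₀ : ℝ}
    (hw : Tendsto w l (𝓝 w₀)) : Tendsto (fun i => a i + δ i * w i) l atTop := by
  refine Tendsto.congr' (EventuallyEq.symm (h.add_mul_eq w)) ?_
  have := (h.tendsto_div_rpow hγ hw).const_add 1
  rw [add_zero] at this
  exact h.a_tendsto.atTop_mul_pos one_pos this

/-- Since δ = a / a^γ, the increment (a + δw)^γ - a^γ equals a^γ((1 + w/a^γ)^γ - 1). It tends to γw₀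
by differentiability of the power at 1. -/
lemma tendsto_pow_mul_exp (h : IsExtremalScale d γ l r a δ κ) (hγ : 0 < γ) {w : ι → ℝ} {w₀ : ℝ}
    (hw : Tendsto w l (𝓝 w₀)) :
    Tendsto (fun i => r i ^ d * Real.exp (-(a i + δ i * w i) ^ γ)) l
      (𝓝 (Real.exp (-γ * w₀))) := by
  have hder : HasFDerivAt (fun x : ℝ => x ^ γ)
      (ContinuousLinearMap.toSpanSingleton ℝ γ) (1 : ℝ) := by
    have := (Real.hasDerivAt_rpow_const (x := 1) (p := γ) (Or.inl one_ne_zero))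
    simpa using this.hasFDerivAt
  have hc : Tendsto (fun i => a i ^ γ • ((a i ^ γ)⁻¹ * w i)) l (𝓝 w₀) := by
    refine hw.congr' ?_
    filter_upwards [(h.tendsto_rpow hγ).eventually_gt_atTop 0] with i hi
    rw [smul_eq_mul, mul_inv_cancel_left₀ hi.ne']
  have hlim := hder.hasFDerivWithinAt (s := Set.univ).lim (h.tendsto_div_rpow hγ hw)
    (Eventually.of_forall fun _ => Set.mem_univ _) hc
  have hexp := (Real.continuous_exp.tendsto _).comp hlim.neg
  have hval : -((ContinuousLinearMap.toSpanSingleton ℝ γ) w₀) = -γ * w₀ := by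
    simp [mul_comm]
  rw [hval] at hexp
  refine hexp.congr' ?_
  filter_upwards [h.add_mul_eq w, h.one_add_pos hγ hw, h.pow_mul_exp,
    h.a_tendsto.eventually_gt_atTop 0] with i h1 h2 h3 h4
  simp only [Function.comp, smul_eq_mul, Real.one_rpow]
  rw [h1, Real.mul_rpow h4.le h2.le, eq_comm]
  calc r i ^ d * Real.exp (-(a i ^ γ * (1 + (a i ^ γ)⁻¹ * w i) ^ γ))
      = r i ^ d * Real.exp (-a i ^ γ) *
        Real.exp (-(a i ^ γ * ((1 + (a i ^ γ)⁻¹ * w i) ^ γ - 1))) := by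
        rw [mul_assoc, ← Real.exp_add]
        ring_nf
    _ = _ := by rw [h3, one_mul]

lemma tendsto_mul_rpow (h : IsExtremalScale d γ l r a δ κ) (hγ : 0 < γ) {w : ι → ℝ} {w₀ : ℝ}
    (hw : Tendsto w l (𝓝 w₀)) :
    Tendsto (fun i => δ i * (a i + δ i * w i) ^ (γ - 1)) l (𝓝 1) := by
  have hone := (h.tendsto_div_rpow hγ hw).const_add 1
  rw [add_zero] at hone
  have hlim := hone.rpow_const (p := γ - 1) (Or.inl one_ne_zero)
  rw [Real.one_rpow] at hlim
  refine hlim.congr' ?_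
  filter_upwards [h.add_mul_eq w, h.one_add_pos hγ hw, h.mul_rpow,
    h.a_tendsto.eventually_gt_atTop 0] with i h1 h2 h3 h4
  rw [h1, Real.mul_rpow h4.le h2.le, ← mul_assoc, h3, one_mul]

lemma tendsto_penalty (h : IsExtremalScale d γ l r a δ κ) (x : Fin d → ℝ) :
    Tendsto (fun i => κ i * l1 (toReal (cell (r i) x)) / δ i) l (𝓝 (theta d γ * l1 x)) := by
  refine (h.slope_tendsto.mul (tendsto_l1_cell_div h.r_tendsto x)).congr' ?_
  filter_upwards [h.r_tendsto.eventually_gt_atTop 0, h.δ_pos] with i hr hδ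
  field_simp

lemma add_penalty_eq (h : IsExtremalScale d γ l r a δ κ) (x : Fin d → ℝ) (y : ℝ) :
    ∀ᶠ i in l, a i + δ i * y + κ i * l1 (toReal (cell (r i) x)) =
      a i + δ i * (y + κ i * l1 (toReal (cell (r i) x)) / δ i) := by
  filter_upwards [h.δ_pos] with i hδ
  rw [mul_add, mul_div_cancel₀ _ hδ.ne', add_assoc]

lemma tendsto_smearedDensity (h : IsExtremalScale d γ l r a δ κ) (hγ : 0 < γ)
    (q : (Fin d → ℝ) × ℝ) :
    Tendsto (fun i => smearedDensity γ (r i) (a i) (δ i) (κ i) q) l (𝓝 (intensity d γ q)) := by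
  have hw := (h.tendsto_penalty q.1).const_add q.2
  have hlim := ((h.tendsto_mul_rpow hγ hw).mul (h.tendsto_pow_mul_exp hγ hw)).const_mul γ
  rw [one_mul] at hlim
  refine hlim.congr' ?_
  filter_upwards [h.add_penalty_eq q.1 q.2, (h.add_mul_tendsto hγ hw).eventually_gt_atTop 0]
    with i h1 h2
  rw [smearedDensity, h1, weibullDensity_of_pos γ h2]
  ring

lemma eventually_slope_pos (h : IsExtremalScale d γ l r a δ κ) (hd : 0 < d) (hγ : 0 < γ) :
    ∀ᶠ i in l, 0 < κ i := by
  filter_upwards [h.slope_tendsto.eventually (lt_mem_nhds (theta_pos hd hγ)), h.δ_pos,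
    h.r_tendsto.eventually_gt_atTop 0] with i h1 h2 h3
  rw [div_pos_iff_of_pos_right h2] at h1
  exact (pos_iff_pos_of_mul_pos h1).1 h3

/-- An integrable bound for the rescaled number of exceedances. -/
lemma pow_mul_exp_le (h : IsExtremalScale d γ l r a δ κ) (hd : 0 < d) (hγ : 0 < γ) (y : ℝ)
    (k : ℕ) : ∃ C, ∀ᶠ i in l, ∀ x : Fin d → ℝ,
      r i ^ d * Real.exp (-(a i + δ i * y + κ i * l1 (toReal (cell (r i) x))) ^ γ) ≤
        C * (1 + ‖x‖) ^ (-(min γ 1 * k)) := by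
  have hθ := theta_pos hd hγ
  set m := min γ 1 with hm
  have hm0 : 0 < m := lt_min hγ one_pos
  set β := theta d γ / 2 with hβ
  have hβ0 : 0 < β := by positivity
  set c₀ := min β 1 / (1 + (d : ℝ)) with hc₀
  have hc₀0 : 0 < c₀ := by
    have : 0 < min β 1 := lt_min hβ0 one_pos
    positivity
  set C₁ := Real.exp (-γ * y) + 1 with hC₁
  refine ⟨C₁ * Real.exp 1 * (k.factorial * c₀ ^ (-(m * k))), ?_⟩
  have hconst := tendsto_const_nhds (x := y) (f := l)
  have hv := h.add_mul_tendsto hγ hconst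
  have hM := (tendsto_rpow_atTop hγ).comp hv
  have hslope := (h.tendsto_mul_rpow hγ hconst).mul h.slope_tendsto
  rw [one_mul] at hslope
  filter_upwards [(h.tendsto_pow_mul_exp hγ hconst).eventually (gt_mem_nhds (lt_add_one _)),
    hv.eventually_gt_atTop 0, hM.eventually_ge_atTop 1, h.δ_pos, h.eventually_slope_pos hd hγ,
    hslope.eventually (lt_mem_nhds (by linarith : β < theta d γ)),
    h.r_tendsto.eventually_ge_atTop 1] with i h1 h2 h3 h4 h5 h6 h7 x
  simp only [Function.comp] at h3
  set v := a i + δ i * y with hvdef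
  set s := l1 (toReal (cell (r i) x)) with hs
  have hs0 : 0 ≤ s := l1_nonneg _
  have hr0 : 0 < r i := by linarith
  -- W is, up to the factor γ, the first order increment of the exponent v^γ caused by the penalty
  -- κs. It is comparable with the rescaled distance s / r, because δv^(γ-1) → 1 and rκ/δ → θ.
  set W := v ^ γ * (κ i * s / v) with hW
  have hvγ : v ^ γ = v ^ (γ - 1) * v := by
    rw [Real.rpow_sub_one h2.ne', div_mul_cancel₀ _ h2.ne']
  have hv1 : 0 < v ^ (γ - 1) := Real.rpow_pos_of_pos h2 _
  have hW0 : 0 ≤ W := by positivity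
  have hWeq : W = (δ i * v ^ (γ - 1) * (r i * κ i / δ i)) * (s / r i) := by
    rw [hW, hvγ]
    field_simp
  -- Rounding moves the ℓ¹-norm by at most d, hence by at most d after division by r ≥ 1.
  have hsr : max (l1 x - d) 0 ≤ s / r i := by
    refine max_le ?_ (by positivity)
    rw [le_div_iff₀ hr0]
    have := (abs_le.1 (abs_l1_cell_sub_le hr0.le x)).1
    have hd0 : (0 : ℝ) ≤ d := Nat.cast_nonneg d
    nlinarith
  have hWβ : β * max (l1 x - d) 0 ≤ W := by
    rw [hWeq]
    exact mul_le_mul h6.le hsr (le_max_right _ _) (hβ0.le.trans h6.le)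
  have hU : c₀ * (1 + ‖x‖) ≤ 1 + W := by
    have := min_div_mul_le (β := β) (D := d) (s := l1 x) hβ0 (Nat.cast_nonneg d)
    have h8 := mul_le_mul_of_nonneg_left (norm_le_l1 x) hc₀0.le
    rw [← hc₀] at this
    linarith
  have hU0 : 0 < c₀ * (1 + ‖x‖) := by positivity
  have hfac : (v + κ i * s) ^ γ = v ^ γ + v ^ γ * ((1 + W / v ^ γ) ^ γ - 1) := by
    have : v + κ i * s = v * (1 + W / v ^ γ) := by
      rw [hW]
      have : v ^ γ ≠ 0 := (Real.rpow_pos_of_pos h2 γ).ne'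
      field_simp
    rw [this, Real.mul_rpow h2.le (by positivity)]
    ring
  have hbern := one_add_rpow_min_le hγ h3 hW0
  have hmono : (c₀ * (1 + ‖x‖)) ^ m ≤ (1 + W) ^ m := Real.rpow_le_rpow hU0.le hU hm0.le
  calc r i ^ d * Real.exp (-(v + κ i * s) ^ γ)
      = r i ^ d * Real.exp (-v ^ γ) *
          Real.exp (-(v ^ γ * ((1 + W / v ^ γ) ^ γ - 1))) := by
        rw [hfac, neg_add, Real.exp_add, mul_assoc]
    _ ≤ C₁ * Real.exp (1 + -(c₀ * (1 + ‖x‖)) ^ m) := by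
        gcongr
        linarith
    _ = C₁ * Real.exp 1 * Real.exp (-(c₀ * (1 + ‖x‖)) ^ m) := by
        rw [Real.exp_add, mul_assoc]
    _ ≤ C₁ * Real.exp 1 * (k.factorial * (c₀ * (1 + ‖x‖)) ^ (-(m * k))) := by
        gcongr
        exact exp_neg_rpow_le hU0 k
    _ = _ := by
        rw [Real.mul_rpow hc₀0.le (by positivity)]
        ring

lemma tendsto_exceedanceMean [l.IsCountablyGenerated] (h : IsExtremalScale d γ l r a δ κ)
    (hd : 0 < d) (hγ : 0 < γ) (y : ℝ) :
    Tendsto (fun i => exceedanceMean d γ (κ i) (a i + δ i * y)) l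
      (𝓝 (ENNReal.ofReal (massConst d γ * Real.exp (-γ * y)))) := by
  have hm0 : 0 < min γ 1 := lt_min hγ one_pos
  -- This k makes the decay exponent min γ 1 * k exceed d, so that the dominating function is
  -- integrable on ℝ^d.
  obtain ⟨k, hk⟩ := exists_nat_gt ((d : ℝ) / min γ 1)
  rw [div_lt_iff₀' hm0] at hk
  obtain ⟨C, hC⟩ := h.pow_mul_exp_le hd hγ y k
  have hint : Integrable fun x : Fin d → ℝ => C * (1 + ‖x‖) ^ (-(min γ 1 * k)) :=
    (integrable_one_add_norm (by simpa using hk)).const_mul C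
  rw [← lintegral_exp_neg_add_theta hd hγ y]
  have hmain := tendsto_lintegral_filter_of_dominated_convergence (μ := volume) (l := l)
    (F := fun i (x : Fin d → ℝ) => ENNReal.ofReal (r i ^ d) * ENNReal.ofReal
      (Real.exp (-(a i + δ i * y + κ i * l1 (toReal (cell (r i) x))) ^ γ)))
    (f := fun x => ENNReal.ofReal (Real.exp (-γ * (y + theta d γ * l1 x))))
    (fun x => ENNReal.ofReal (C * (1 + ‖x‖) ^ (-(min γ 1 * k)))) ?_ ?_ ?_ ?_
  · refine hmain.congr' ?_
    filter_upwards [h.r_tendsto.eventually_gt_atTop 0] with i hi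
    rw [exceedanceMean, tsum_eq_lintegral_cell hi]
  · refine Eventually.of_forall fun i => ?_
    have := measurable_l1_cell (d := d) (r i)
    fun_prop
  · filter_upwards [hC, h.r_tendsto.eventually_gt_atTop 0] with i hi hr
    refine Eventually.of_forall fun x => ?_
    rw [← ENNReal.ofReal_mul (by positivity)]
    exact ENNReal.ofReal_le_ofReal (hi x)
  · exact hint.lintegral_lt_top.ne
  · refine Eventually.of_forall fun x => ?_
    have hw := (h.tendsto_penalty x).const_add y
    refine (ENNReal.tendsto_ofReal (h.tendsto_pow_mul_exp hγ hw)).congr' ?_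
    filter_upwards [h.add_penalty_eq x y, h.r_tendsto.eventually_gt_atTop 0] with i h1 hr
    rw [h1, ENNReal.ofReal_mul (by positivity)]

/-- The vertex of the cone goes to infinity, so the correction 1 - q tends to 1 and the bound
becomes the void probability of the Poisson limit. -/
lemma tendsto_voidBound [l.IsCountablyGenerated] (h : IsExtremalScale d γ l r a δ κ)
    (hd : 0 < d) (hγ : 0 < γ) (y : ℝ) :
    Tendsto (fun i => voidBound d γ (κ i) (a i + δ i * y)) l
      (𝓝 (ENNReal.ofReal (Real.exp (-(massConst d γ * Real.exp (-γ * y)))))) := by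
  have hN := h.tendsto_exceedanceMean hd hγ y
  have hK := massConst_pos hd hγ
  have hv := h.add_mul_tendsto hγ (tendsto_const_nhds (x := y))
  have hN' := (ENNReal.tendsto_toReal ENNReal.ofReal_ne_top).comp hN
  rw [ENNReal.toReal_ofReal (by positivity)] at hN'
  have hq : Tendsto (fun i => 1 - Real.exp (-(a i + δ i * y) ^ γ)) l (𝓝 1) := by
    have := (Real.tendsto_exp_neg_atTop_nhds_zero.comp
      ((tendsto_rpow_atTop hγ).comp hv)).const_sub 1
    simpa using this
  have hlim := ENNReal.tendsto_ofReal ((Real.continuous_exp.tendsto _).comp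
    (hN'.div hq one_ne_zero).neg)
  rw [div_one] at hlim
  refine hlim.congr' ?_
  filter_upwards [hv.eventually_gt_atTop 0,
    hN.eventually (eventually_ne_nhds ENNReal.ofReal_ne_top)] with i h1 h2
  rw [voidBound, if_pos ⟨h1, h2⟩]
  rfl

end IsExtremalScale

/-! ### The two highest points -/

section Order

variable {S : Type*} {ψ : S → ℝ} {z₁ z₂ w : S}

/-- `z₁` and `z₂` carry, without ties, the largest and the second largest value of `ψ`. -/
def IsStrictTopPair (ψ : S → ℝ) (z₁ z₂ : S) : Prop :=
  z₁ ≠ z₂ ∧ ψ z₂ < ψ z₁ ∧ ∀ z, z ≠ z₁ → z ≠ z₂ → ψ z < ψ z₂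

lemma IsStrictTopPair.lt_fst (h : IsStrictTopPair ψ z₁ z₂) (hw : w ≠ z₁) : ψ w < ψ z₁ := by
  by_cases h2 : w = z₂
  · exact h2 ▸ h.2.1
  · exact (h.2.2 w hw h2).trans h.2.1

lemma IsStrictTopPair.isFirstMaximiser (h : IsStrictTopPair ψ z₁ z₂) :
    IsFirstMaximiser ψ z₁ := fun w => by
  by_cases hw : w = z₁
  · rw [hw]
  · exact (h.lt_fst hw).le

lemma IsStrictTopPair.eq_fst (h : IsStrictTopPair ψ z₁ z₂) (hw : IsFirstMaximiser ψ w) :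
    w = z₁ := by
  by_contra hne
  exact (h.lt_fst hne).not_ge (hw z₁)

lemma IsStrictTopPair.isSecondMaximiser (h : IsStrictTopPair ψ z₁ z₂) :
    IsSecondMaximiser ψ z₁ z₂ := ⟨h.1.symm, fun w hw => by
  by_cases h2 : w = z₂
  · rw [h2]
  · exact (h.2.2 w hw h2).le⟩

lemma IsStrictTopPair.eq_snd (h : IsStrictTopPair ψ z₁ z₂) (hw : IsSecondMaximiser ψ z₁ w) :
    w = z₂ := by
  by_contra hne
  exact (h.2.2 w hw.1 hne).not_ge (hw.2 z₂ h.1.symm)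

end Order

/-! ### The rescaled point process -/

variable {d : ℕ} {γ : ℝ}

/-- The value at a lattice point with potential `p.2`, penalised by the distance to the origin. -/
noncomputable def height (κ : ℝ) (p : (Fin d → ℤ) × ℝ) : ℝ := p.2 - κ * l1 (toReal p.1)

/-- The rescaled position and height of a point of the field. -/
noncomputable def rescaledPoint (r a δ κ : ℝ) (p : (Fin d → ℤ) × ℝ) : (Fin d → ℝ) × ℝ :=
  (r⁻¹ • toReal p.1, (height κ p - a) / δ)

/-- The point of the field that is smeared to a given point of the rescaled picture. -/
noncomputable def liftPoint (r a δ κ : ℝ) (q : (Fin d → ℝ) × ℝ) : (Fin d → ℤ) × ℝ :=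
  (cell r q.1, a + δ * q.2 + κ * l1 (toReal (cell r q.1)))

lemma measurable_height (κ : ℝ) : Measurable (height (d := d) κ) := by
  have : Measurable fun p : (Fin d → ℤ) × ℝ => l1 (toReal p.1) :=
    (measurable_of_countable fun z : Fin d → ℤ => l1 (toReal z)).comp measurable_fst
  unfold height
  fun_prop

lemma measurable_rescaledPoint (r a δ κ : ℝ) : Measurable (rescaledPoint (d := d) r a δ κ) := by
  have h1 : Measurable fun p : (Fin d → ℤ) × ℝ => r⁻¹ • toReal p.1 :=
    (measurable_of_countable fun z : Fin d → ℤ => r⁻¹ • toReal z).comp measurable_fst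
  exact h1.prodMk (((measurable_height κ).sub_const a).div_const δ)

lemma measurable_liftPoint (r a δ κ : ℝ) : Measurable (liftPoint (d := d) r a δ κ) := by
  have h1 : Measurable fun q : (Fin d → ℝ) × ℝ => l1 (toReal (cell r q.1)) :=
    (measurable_l1_cell r).comp measurable_fst
  exact ((measurable_cell r).comp measurable_fst).prodMk (by fun_prop)

lemma height_liftPoint (r a δ κ : ℝ) (q : (Fin d → ℝ) × ℝ) :
    height κ (liftPoint r a δ κ q) = a + δ * q.2 := by
  simp [height, liftPoint]

lemma rescaledPoint_liftPoint (r a κ : ℝ) {δ : ℝ} (hδ : δ ≠ 0) (q : (Fin d → ℝ) × ℝ) :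
    rescaledPoint r a δ κ (liftPoint r a δ κ q) = (r⁻¹ • toReal (cell r q.1), q.2) := by
  rw [rescaledPoint, height_liftPoint]
  simp [liftPoint, hδ]

/-- `tsum_lintegral_weibull` used twice, for the second point with the first one frozen and then for
the first; Tonelli's theorem moves the inner sum past the integral over s₁. -/
lemma tsum_tsum_lintegral_weibull (hγ : 0 < γ) (a κ : ℝ) {r δ : ℝ} (hr : 0 < r) (hδ : 0 < δ)
    {Φ : ((Fin d → ℤ) × ℝ) × ((Fin d → ℤ) × ℝ) → ENNReal} (hΦ : Measurable Φ) :
    ∑' z₁, ∑' z₂, ∫⁻ s₁, ∫⁻ s₂, Φ ((z₁, s₁), (z₂, s₂)) ∂weibull γ ∂weibull γ =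
      ∫⁻ w : ((Fin d → ℝ) × ℝ) × ((Fin d → ℝ) × ℝ),
        ENNReal.ofReal (smearedDensity γ r a δ κ w.1) *
          (ENNReal.ofReal (smearedDensity γ r a δ κ w.2) *
            Φ (liftPoint r a δ κ w.1, liftPoint r a δ κ w.2)) := by
  have := isProbabilityMeasure_weibull hγ
  have hsd := measurable_smearedDensity (d := d) γ r a δ κ
  have hl := measurable_liftPoint (d := d) r a δ κ
  have hinner : ∀ p : (Fin d → ℤ) × ℝ, ∑' z₂, ∫⁻ s₂, Φ (p, (z₂, s₂)) ∂weibull γ =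
      ∫⁻ q, ENNReal.ofReal (smearedDensity γ r a δ κ q) * Φ (p, liftPoint r a δ κ q) :=
    fun p => tsum_lintegral_weibull (F := fun z s => Φ (p, (z, s))) γ a κ hr hδ
      fun z => by fun_prop
  have hswap : ∀ z₁, ∑' z₂, ∫⁻ s₁, ∫⁻ s₂, Φ ((z₁, s₁), (z₂, s₂)) ∂weibull γ ∂weibull γ =
      ∫⁻ s₁, (∫⁻ q, ENNReal.ofReal (smearedDensity γ r a δ κ q) *
        Φ ((z₁, s₁), liftPoint r a δ κ q)) ∂weibull γ := fun z₁ => by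
    rw [← lintegral_tsum]
    · exact lintegral_congr fun s₁ => hinner (z₁, s₁)
    · intro z₂
      have : Measurable fun p : ℝ × ℝ => Φ ((z₁, p.1), (z₂, p.2)) := by fun_prop
      exact this.lintegral_prod_right'.aemeasurable
  have hjoint : Measurable fun p : ((Fin d → ℤ) × ℝ) × ((Fin d → ℝ) × ℝ) =>
      ENNReal.ofReal (smearedDensity γ r a δ κ p.2) * Φ (p.1, liftPoint r a δ κ p.2) := by
    fun_prop
  simp_rw [hswap]
  rw [tsum_lintegral_weibull (F := fun z s => ∫⁻ q,
    ENNReal.ofReal (smearedDensity γ r a δ κ q) * Φ ((z, s), liftPoint r a δ κ q))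
    γ a κ hr hδ fun z => (hjoint.lintegral_prod_right').comp measurable_prodMk_left,
    Measure.volume_eq_prod ((Fin d → ℝ) × ℝ), lintegral_prod]
  · refine lintegral_congr fun q => ?_
    exact (lintegral_const_mul _
      (hjoint.comp (measurable_prodMk_left (x := liftPoint r a δ κ q)))).symm
  · exact (by fun_prop : Measurable _).aemeasurable

variable {G : Set ((Fin d → ℝ) × ℝ × (Fin d → ℝ) × ℝ)}

/-- The pairs of points of the field, the first one being the higher one, whose rescaled positions
and heights lie in `G`. -/
def orderedPairs (r a δ κ : ℝ) (G : Set ((Fin d → ℝ) × ℝ × (Fin d → ℝ) × ℝ)) :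
    Set (((Fin d → ℤ) × ℝ) × ((Fin d → ℤ) × ℝ)) :=
  {p | p.1.1 ≠ p.2.1 ∧ height κ p.2 < height κ p.1 ∧
    MeasurableEquiv.prodAssoc (rescaledPoint r a δ κ p.1, rescaledPoint r a δ κ p.2) ∈ G}

lemma measurableSet_orderedPairs (r a δ κ : ℝ) (hG : MeasurableSet G) :
    MeasurableSet (orderedPairs r a δ κ G) := by
  have hh := measurable_height (d := d) κ
  have hp := measurable_rescaledPoint (d := d) r a δ κ
  have h1 : MeasurableSet {p : ((Fin d → ℤ) × ℝ) × ((Fin d → ℤ) × ℝ) | p.1.1 = p.2.1} :=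
    measurableSet_eq_fun (by fun_prop) (by fun_prop)
  have h2 : MeasurableSet {p : ((Fin d → ℤ) × ℝ) × ((Fin d → ℤ) × ℝ) |
      height κ p.2 < height κ p.1} := measurableSet_lt (by fun_prop) (by fun_prop)
  have h3 : Measurable fun p : ((Fin d → ℤ) × ℝ) × ((Fin d → ℤ) × ℝ) =>
      MeasurableEquiv.prodAssoc (rescaledPoint r a δ κ p.1, rescaledPoint r a δ κ p.2) := by
    fun_prop
  exact h1.compl.inter (h2.inter (h3 hG))

/-- The lower bound for the density of the rescaled and smeared pair of the two highest points,
restricted to `G`. -/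
noncomputable def smearedPairDensity (γ r a δ κ : ℝ)
    (G : Set ((Fin d → ℝ) × ℝ × (Fin d → ℝ) × ℝ))
    (w : ((Fin d → ℝ) × ℝ) × ((Fin d → ℝ) × ℝ)) : ENNReal :=
  ENNReal.ofReal (smearedDensity γ r a δ κ w.1) *
    (ENNReal.ofReal (smearedDensity γ r a δ κ w.2) *
      (orderedPairs r a δ κ G).indicator (fun p => voidBound d γ κ (height κ p.2))
        (liftPoint r a δ κ w.1, liftPoint r a δ κ w.2))

lemma measurable_voidBound_height (κ : ℝ) :
    Measurable fun p : ((Fin d → ℤ) × ℝ) × ((Fin d → ℤ) × ℝ) =>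
      voidBound d γ κ (height κ p.2) :=
  (measurable_voidBound d γ κ).comp ((measurable_height κ).comp measurable_snd)

lemma measurable_smearedPairDensity (r a δ κ : ℝ) (hG : MeasurableSet G) :
    Measurable (smearedPairDensity γ r a δ κ G) := by
  have h1 := measurable_smearedDensity (d := d) γ r a δ κ
  have h2 := measurable_liftPoint (d := d) r a δ κ
  have h3 := (measurable_voidBound_height (γ := γ) κ).indicator
    (measurableSet_orderedPairs r a δ κ hG)
  unfold smearedPairDensity
  fun_prop

/-- The event that the two highest points sit at `z₁` and `z₂` and that their rescaled positions
and heights lie in `G`. -/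
def topPairEvent {Ω : Type*} (ξ : (Fin d → ℤ) → Ω → ℝ) (r a δ κ : ℝ)
    (G : Set ((Fin d → ℝ) × ℝ × (Fin d → ℝ) × ℝ)) (z₁ z₂ : Fin d → ℤ) : Set Ω :=
  {ω | ((z₁, ξ z₁ ω), (z₂, ξ z₂ ω)) ∈ orderedPairs r a δ κ G ∧
    ∀ z, z ≠ z₁ → z ≠ z₂ → ξ z ω - κ * l1 (toReal z) < ξ z₂ ω - κ * l1 (toReal z₂)}

lemma lintegral_smearedPairDensity_le {Ω : Type*} [MeasurableSpace Ω] {P : Measure Ω}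
    [IsProbabilityMeasure P] {ξ : (Fin d → ℤ) → Ω → ℝ} (hξ : IsWeibullPotential P γ ξ)
    (hγ : 0 < γ) (a : ℝ) {r δ κ : ℝ} (hr : 0 < r) (hδ : 0 < δ) (hκ : 0 ≤ κ)
    (hG : MeasurableSet G) :
    ∫⁻ w, smearedPairDensity γ r a δ κ G w ≤
      ∑' z₁, ∑' z₂, P (topPairEvent ξ r a δ κ G z₁ z₂) := by
  have hS := measurableSet_orderedPairs r a δ κ hG
  have heq := tsum_tsum_lintegral_weibull hγ a κ hr hδ
    ((measurable_voidBound_height (γ := γ) κ).indicator hS)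
  unfold smearedPairDensity
  rw [← heq]
  refine ENNReal.tsum_le_tsum fun z₁ => ENNReal.tsum_le_tsum fun z₂ => ?_
  by_cases hz : z₁ = z₂
  · have : ∀ s₁ s₂ : ℝ, (orderedPairs r a δ κ G).indicator
        (fun p => voidBound d γ κ (height κ p.2)) ((z₁, s₁), (z₂, s₂)) = 0 := fun s₁ s₂ =>
      Set.indicator_of_notMem (fun h => h.1 hz) _
    simp [this]
  · exact hξ.lintegral_voidBound_le hγ hκ hz
      (S := {s | ((z₁, s.1), (z₂, s.2)) ∈ orderedPairs r a δ κ G})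
      ((by fun_prop : Measurable fun s : ℝ × ℝ => ((z₁, s.1), (z₂, s.2))) hS)

lemma ae_fst_ne (hd : 0 < d) (x : Fin d → ℝ) : ∀ᵐ q : (Fin d → ℝ) × ℝ, x ≠ q.1 := by
  have : Nonempty (Fin d) := ⟨⟨0, hd⟩⟩
  have hx : ∀ᵐ y : Fin d → ℝ, x ≠ y := by
    refine (measure_eq_zero_iff_ae_notMem.1 (measure_singleton x)).mono fun y hy h => ?_
    exact hy h.symm
  exact Measure.quasiMeasurePreserving_fst.ae hx

/-- Distinct limiting positions lie in distinct cells once r is large, as `orderedPairs` demands;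
coinciding positions are negligible. -/
lemma ae_fst_ne_fst (hd : 0 < d) :
    ∀ᵐ w : ((Fin d → ℝ) × ℝ) × ((Fin d → ℝ) × ℝ), w.1.1 ≠ w.2.1 := by
  have hm : MeasurableSet {w : ((Fin d → ℝ) × ℝ) × ((Fin d → ℝ) × ℝ) | w.1.1 ≠ w.2.1} :=
    (measurableSet_eq_fun (by fun_prop) (by fun_prop)).compl
  exact (Measure.ae_prod_iff_ae_ae hm).2 (Eventually.of_forall fun q => ae_fst_ne hd q.1)

namespace IsExtremalScale

variable {ι : Type*} {l : Filter ι} [l.IsCountablyGenerated] {r a δ κ : ι → ℝ}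

/-- Smearing rounds positions but not heights, and the rounded positions converge. Since G is open,
a pair in G is therefore eventually admissible, and then the three factors converge separately. -/
lemma pairDensity_le_liminf (h : IsExtremalScale d γ l r a δ κ) (hd : 0 < d) (hγ : 0 < γ)
    (hG : IsOpen G) {w : ((Fin d → ℝ) × ℝ) × ((Fin d → ℝ) × ℝ)} (hw : w.1.1 ≠ w.2.1) :
    (MeasurableEquiv.prodAssoc ⁻¹' G).indicator (pairDensity d γ) w ≤
      liminf (fun i => smearedPairDensity γ (r i) (a i) (δ i) (κ i) G w) l := by
  rcases l.eq_or_neBot with rfl | hl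
  · simp
  by_cases hwG : MeasurableEquiv.prodAssoc w ∈ G
  swap
  · rw [Set.indicator_of_notMem (by exact hwG)]
    exact zero_le
  rw [Set.indicator_of_mem (by exact hwG)]
  by_cases hlt : w.2.2 < w.1.2
  swap
  · rw [pairDensity, Set.indicator_of_notMem (by exact hlt), mul_zero]
    exact zero_le
  rw [pairDensity, Set.indicator_of_mem (by exact hlt)]
  have h1 := ENNReal.tendsto_ofReal (h.tendsto_smearedDensity hγ w.1)
  have h2 := ENNReal.tendsto_ofReal (h.tendsto_smearedDensity hγ w.2)
  have h3 := h.tendsto_voidBound hd hγ w.2.2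
  have hx1 := tendsto_cell_div h.r_tendsto w.1.1
  have hx2 := tendsto_cell_div h.r_tendsto w.2.1
  have hpos : Tendsto (fun i => MeasurableEquiv.prodAssoc
      ((((r i)⁻¹ • toReal (cell (r i) w.1.1)), w.1.2),
        (((r i)⁻¹ • toReal (cell (r i) w.2.1)), w.2.2))) l
      (𝓝 (MeasurableEquiv.prodAssoc w)) :=
    hx1.prodMk_nhds (tendsto_const_nhds.prodMk_nhds (hx2.prodMk_nhds tendsto_const_nhds))
  have hlim := ENNReal.Tendsto.mul h1 (Or.inr (by finiteness))
    (ENNReal.Tendsto.mul h2 (Or.inr (by finiteness)) h3 (Or.inr (by finiteness)))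
    (Or.inr ENNReal.ofReal_ne_top)
  have heq : ∀ᶠ i in l, ENNReal.ofReal (smearedDensity γ (r i) (a i) (δ i) (κ i) w.1) *
      (ENNReal.ofReal (smearedDensity γ (r i) (a i) (δ i) (κ i) w.2) *
        voidBound d γ (κ i) (a i + δ i * w.2.2)) =
      smearedPairDensity γ (r i) (a i) (δ i) (κ i) G w := by
    filter_upwards [hpos.eventually (hG.mem_nhds hwG), h.δ_pos, 
      (hx1.sub hx2).eventually_ne (sub_ne_zero.2 hw)]
      with i hi hδ hne
    have hmem : (liftPoint (r i) (a i) (δ i) (κ i) w.1, liftPoint (r i) (a i) (δ i) (κ i) w.2) ∈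
        orderedPairs (r i) (a i) (δ i) (κ i) G := by
      refine ⟨fun he => hne ?_, ?_, ?_⟩
      · simp only [liftPoint] at he
        rw [he, sub_self]
      · rw [height_liftPoint, height_liftPoint]
        gcongr
      · rw [rescaledPoint_liftPoint _ _ _ hδ.ne', rescaledPoint_liftPoint _ _ _ hδ.ne']
        exact hi
    rw [smearedPairDensity, Set.indicator_of_mem hmem, height_liftPoint]
  rw [(hlim.congr' heq).liminf_eq]
  exact le_of_eq (by ring)

lemma limitLaw_le_liminf (h : IsExtremalScale d γ l r a δ κ) (hd : 0 < d) (hγ : 0 < γ)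
    {Ω : Type*} [MeasurableSpace Ω] {P : Measure Ω} [IsProbabilityMeasure P]
    {ξ : (Fin d → ℤ) → Ω → ℝ} (hξ : IsWeibullPotential P γ ξ) (hG : IsOpen G) :
    limitLaw d γ G ≤ liminf (fun i =>
      ∑' z₁, ∑' z₂, P (topPairEvent ξ (r i) (a i) (δ i) (κ i) G z₁ z₂)) l := by
  have hGm := hG.measurableSet
  calc limitLaw d γ G
      = ∫⁻ w, (MeasurableEquiv.prodAssoc ⁻¹' G).indicator (pairDensity d γ) w :=
        limitLaw_apply hγ hGm
    _ ≤ ∫⁻ w, liminf (fun i => smearedPairDensity γ (r i) (a i) (δ i) (κ i) G w) l :=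
        lintegral_mono_ae ((ae_fst_ne_fst hd).mono fun w hw =>
          h.pairDensity_le_liminf hd hγ hG hw)
    _ ≤ liminf (fun i => ∫⁻ w, smearedPairDensity γ (r i) (a i) (δ i) (κ i) G w) l :=
        lintegral_liminf_le fun i => measurable_smearedPairDensity _ _ _ _ hGm
    _ ≤ _ := by
        refine liminf_le_liminf ?_
        filter_upwards [h.r_tendsto.eventually_gt_atTop 0, h.δ_pos,
          h.eventually_slope_pos hd hγ] with i hr hδ hκ
        exact lintegral_smearedPairDensity_le hξ hγ _ hr hδ hκ.le hGm

end IsExtremalScale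

/-! ### The scales of the parabolic Anderson model -/

variable {d : ℕ} {γ : ℝ}

/-- The slope of the penalty in `Psi`. -/
noncomputable def slope (γ c t : ℝ) : ℝ := Real.log (Real.log t) / (γ * t) - c / t

lemma Psi_eq_sub_slope (γ : ℝ) (v : (Fin d → ℤ) → ℝ) (c t : ℝ) (z : Fin d → ℤ) :
    Psi γ v c t z = v z - slope γ c t * l1 (toReal z) := by
  unfold Psi slope
  ring

lemma tendsto_loglog : Tendsto (fun t => Real.log (Real.log t)) atTop atTop :=
  Real.tendsto_log_atTop.comp Real.tendsto_log_atTop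

lemma log_rScale (γ : ℝ) : ∀ᶠ t in atTop, Real.log (rScale γ t) =
    Real.log t + (1 / γ - 1) * Real.log (Real.log t) - Real.log (Real.log (Real.log t)) := by
  filter_upwards [eventually_gt_atTop 0, Real.tendsto_log_atTop.eventually_gt_atTop 0,
    tendsto_loglog.eventually_gt_atTop 0] with t h1 h2 h3
  have h4 := Real.rpow_pos_of_pos h2 (1 / γ - 1)
  rw [rScale, Real.log_div (mul_pos h1 h4).ne' h3.ne', Real.log_mul h1.ne' h4.ne',
    Real.log_rpow h2]

lemma tendsto_log_rScale_div_log (γ : ℝ) :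
    Tendsto (fun t => Real.log (rScale γ t) / Real.log t) atTop (𝓝 1) := by
  have h0 : Tendsto (fun x => Real.log x / x) atTop (𝓝 0) :=
    Real.isLittleO_log_id_atTop.tendsto_div_nhds_zero
  have h1 := h0.comp Real.tendsto_log_atTop
  have h2 := (h0.comp tendsto_loglog).mul h1
  have hlim := ((h1.const_mul (1 / γ - 1)).const_add 1).sub h2
  simp only [mul_zero, add_zero, sub_zero] at hlim
  refine hlim.congr' ?_
  filter_upwards [log_rScale γ, Real.tendsto_log_atTop.eventually_gt_atTop 0,
    tendsto_loglog.eventually_gt_atTop 0] with t h3 h4 h5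
  rw [h3]
  simp only [Function.comp]
  field_simp

lemma rScale_pos (γ : ℝ) : ∀ᶠ t in atTop, 0 < rScale γ t := by
  filter_upwards [eventually_gt_atTop 0, Real.tendsto_log_atTop.eventually_gt_atTop 0,
    tendsto_loglog.eventually_gt_atTop 0] with t h1 h2 h3
  have h4 := Real.rpow_pos_of_pos h2 (1 / γ - 1)
  unfold rScale
  positivity

lemma tendsto_log_rScale (γ : ℝ) : Tendsto (fun t => Real.log (rScale γ t)) atTop atTop := by
  refine (Real.tendsto_log_atTop.atTop_mul_pos one_pos (tendsto_log_rScale_div_log γ)).congr' ?_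
  filter_upwards [Real.tendsto_log_atTop.eventually_gt_atTop 0] with t ht
  field_simp

lemma tendsto_rScale (γ : ℝ) : Tendsto (rScale γ) atTop atTop := by
  refine (Real.tendsto_exp_atTop.comp (tendsto_log_rScale γ)).congr' ?_
  filter_upwards [rScale_pos γ] with t ht
  exact Real.exp_log ht

/-- Follows from log r_t ~ log t. It reconciles the unit d_t of the good event with the unit d_{r_t}
of the limit theorem. -/
lemma tendsto_dScale_rScale_div (hd : 0 < d) (γ : ℝ) :
    Tendsto (fun t => dScale d γ (rScale γ t) / dScale d γ t) atTop (𝓝 1) := by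
  have hd0 : (0 : ℝ) < d := by exact_mod_cast hd
  have := (tendsto_log_rScale_div_log γ).rpow_const (p := 1 / γ - 1) (Or.inl one_ne_zero)
  rw [Real.one_rpow] at this
  refine this.congr' ?_
  filter_upwards [Real.tendsto_log_atTop.eventually_gt_atTop 0,
    (tendsto_log_rScale γ).eventually_gt_atTop 0] with t h1 h2
  rw [dScale, dScale, ← Real.div_rpow (by positivity) (by positivity),
    mul_div_mul_left _ _ hd0.ne']

lemma dScale_pos (hd : 0 < d) (γ : ℝ) : ∀ᶠ t in atTop, 0 < dScale d γ t := by
  have hd0 : (0 : ℝ) < d := by exact_mod_cast hd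
  filter_upwards [Real.tendsto_log_atTop.eventually_gt_atTop 0] with t ht
  unfold dScale
  positivity

lemma isExtremalScale_rScale (hd : 0 < d) (hγ : 0 < γ) (c : ℝ) :
    IsExtremalScale d γ atTop (rScale γ) (fun t => aScale d γ (rScale γ t))
      (fun t => dScale d γ (rScale γ t)) (slope γ c) := by
  have hd0 : (0 : ℝ) < d := by exact_mod_cast hd
  refine ⟨tendsto_rScale γ, ?_, ?_, ?_, ?_, ?_⟩
  · exact (tendsto_rpow_atTop (by positivity)).comp
      ((tendsto_log_rScale γ).const_mul_atTop hd0)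
  · exact (tendsto_rScale γ).eventually (dScale_pos hd γ)
  · filter_upwards [rScale_pos γ, (tendsto_log_rScale γ).eventually_gt_atTop 0] with t h1 h2
    rw [aScale, ← Real.rpow_mul (by positivity), one_div_mul_cancel hγ.ne', Real.rpow_one,
      Real.exp_neg, ← Real.log_pow, Real.exp_log (by positivity), mul_inv_cancel₀ (by positivity)]
  · filter_upwards [(tendsto_log_rScale γ).eventually_gt_atTop 0] with t h2
    have h3 : 0 < d * Real.log (rScale γ t) := by positivity
    rw [aScale, dScale, ← Real.rpow_mul h3.le, ← Real.rpow_add h3]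
    have : 1 / γ - 1 + 1 / γ * (γ - 1) = 0 := by field_simp; ring
    rw [this, Real.rpow_zero]
  -- Exactly, rκ/δ = (1/γ - c/log log t) · d_t/d_{r_t} · d^(1 - 1/γ); the contribution of c vanishes
  -- in the limit.
  · have h1 : Tendsto (fun t => 1 / γ - c / Real.log (Real.log t)) atTop (𝓝 (1 / γ)) := by
      simpa using (tendsto_const_nhds.div_atTop tendsto_loglog).const_sub (1 / γ)
    have h2 : Tendsto (fun t => dScale d γ (rScale γ t) / dScale d γ t) atTop (𝓝 1) :=
      tendsto_dScale_rScale_div hd γ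
    have h3 := (h1.mul (h2.inv₀ one_ne_zero)).mul_const ((d : ℝ) ^ (1 - 1 / γ))
    have h4 : 1 / γ * 1⁻¹ * (d : ℝ) ^ (1 - 1 / γ) = theta d γ := by
      rw [theta]
      simp
    rw [h4] at h3
    refine h3.congr' ?_
    filter_upwards [eventually_gt_atTop 0, Real.tendsto_log_atTop.eventually_gt_atTop 0,
      tendsto_loglog.eventually_gt_atTop 0, dScale_pos hd γ,
      (tendsto_rScale γ).eventually (dScale_pos hd γ)] with t ht h5 h6 h7 h8
    have h9 : (d : ℝ) ^ (1 - 1 / γ) = ((d : ℝ) ^ (1 / γ - 1))⁻¹ := by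
      rw [← Real.rpow_neg hd0.le, neg_sub]
    have h10 : dScale d γ t = (d : ℝ) ^ (1 / γ - 1) * Real.log t ^ (1 / γ - 1) := by
      rw [dScale, Real.mul_rpow hd0.le h5.le]
    have h11 := Real.rpow_pos_of_pos hd0 (1 / γ - 1)
    rw [h9, h10, rScale, slope]
    field_simp

variable {Ω : Type*} {ξ : (Fin d → ℤ) → Ω → ℝ} {Z₁ Z₂ : ℝ → ℝ → Ω → (Fin d → ℤ)}

lemma isStrictTopPair_of_mem_topPairEvent {r a δ c t : ℝ}
    {G : Set ((Fin d → ℝ) × ℝ × (Fin d → ℝ) × ℝ)} {z₁ z₂ : Fin d → ℤ} {ω : Ω}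
    (h : ω ∈ topPairEvent ξ r a δ (slope γ c t) G z₁ z₂) :
    IsStrictTopPair (Psi γ (ξ · ω) c t) z₁ z₂ := by
  refine ⟨h.1.1, ?_, fun z hz₁ hz₂ => ?_⟩
  · rw [Psi_eq_sub_slope, Psi_eq_sub_slope]
    exact h.1.2.1
  · rw [Psi_eq_sub_slope, Psi_eq_sub_slope]
    exact h.2 z hz₁ hz₂

/-! ### Separated pairs and the good event -/

lemma continuous_l1 : Continuous (l1 (d := d)) := by
  unfold l1
  fun_prop

/-- The pairs of points that are separated from each other and from the origin and bounded, at
precision `1 / (n + 1)`. -/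
def separatedPairs (d : ℕ) (n : ℕ) : Set ((Fin d → ℝ) × ℝ × (Fin d → ℝ) × ℝ) :=
  {q | 1 / (n + 1 : ℝ) < l1 q.1 ∧ 1 / (n + 1 : ℝ) < q.2.1 - q.2.2.2 ∧ l1 q.1 < n ∧
    l1 q.2.2.1 < n ∧ -(n : ℝ) < q.2.1 ∧ -(n : ℝ) < q.2.2.2}

lemma isOpen_separatedPairs (n : ℕ) : IsOpen (separatedPairs d n) := by
  have h := continuous_l1 (d := d)
  have h1 : Continuous fun q : (Fin d → ℝ) × ℝ × (Fin d → ℝ) × ℝ => l1 q.1 :=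
    h.comp continuous_fst
  have h2 : Continuous fun q : (Fin d → ℝ) × ℝ × (Fin d → ℝ) × ℝ => l1 q.2.2.1 :=
    h.comp (by fun_prop)
  unfold separatedPairs
  refine IsOpen.and ?_ (IsOpen.and ?_ (IsOpen.and ?_ (IsOpen.and ?_ (IsOpen.and ?_ ?_)))) <;>
    exact isOpen_lt (by fun_prop) (by fun_prop)

lemma monotone_separatedPairs : Monotone (separatedPairs d) := by
  rintro m n hmn q ⟨h1, h2, h3, h4, h5, h6⟩
  have hc : (m : ℝ) ≤ n := by exact_mod_cast hmn
  have hi : 1 / (n + 1 : ℝ) ≤ 1 / (m + 1 : ℝ) := by gcongr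
  exact ⟨hi.trans_lt h1, hi.trans_lt h2, h3.trans_le hc, h4.trans_le hc, by linarith, by linarith⟩

lemma mem_iUnion_separatedPairs {q : (Fin d → ℝ) × ℝ × (Fin d → ℝ) × ℝ} (hq : q.1 ≠ 0)
    (hlt : q.2.2.2 < q.2.1) : q ∈ ⋃ n, separatedPairs d n := by
  have hl : 0 < l1 q.1 := (norm_pos_iff.2 hq).trans_le (norm_le_l1 q.1)
  have h0 := tendsto_one_div_add_atTop_nhds_zero_nat (𝕜 := ℝ)
  have hn := tendsto_natCast_atTop_atTop (R := ℝ)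
  obtain ⟨n, h1, h2, h3, h4, h5, h6⟩ := ((h0.eventually (gt_mem_nhds hl)).and
    ((h0.eventually (gt_mem_nhds (sub_pos.2 hlt))).and
    ((hn.eventually_gt_atTop (l1 q.1)).and ((hn.eventually_gt_atTop (l1 q.2.2.1)).and
    ((hn.eventually_gt_atTop (-q.2.1)).and (hn.eventually_gt_atTop (-q.2.2.2))))))).exists
  exact Set.mem_iUnion.2 ⟨n, h1, h2, h3, h4, by linarith, by linarith⟩

lemma limitLaw_iUnion_separatedPairs (hd : 0 < d) (hγ : 0 < γ) :
    limitLaw d γ (⋃ n, separatedPairs d n) = 1 := by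
  rw [limitLaw_apply hγ (MeasurableSet.iUnion fun n => (isOpen_separatedPairs n).measurableSet),
    ← lintegral_pairDensity hd hγ]
  have hne : ∀ᵐ w : ((Fin d → ℝ) × ℝ) × ((Fin d → ℝ) × ℝ), (0 : Fin d → ℝ) ≠ w.1.1 :=
    Measure.quasiMeasurePreserving_fst.ae (ae_fst_ne hd 0)
  refine lintegral_congr_ae (hne.mono fun w hw => ?_)
  by_cases hlt : w.2.2 < w.1.2
  · have hmem : w ∈ MeasurableEquiv.prodAssoc ⁻¹' ⋃ n, separatedPairs d n :=
      mem_iUnion_separatedPairs (q := (w.1.1, w.1.2, w.2)) (Ne.symm hw) hlt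
    exact Set.indicator_of_mem hmem _
  · refine Set.indicator_apply_eq_self.2 fun _ => ?_
    rw [pairDensity, Set.indicator_of_notMem (by exact hlt), mul_zero]

lemma l1_smul {x : ℝ} (hx : 0 ≤ x) (y : Fin d → ℝ) : l1 (x • y) = x * l1 y := by
  simp [l1, abs_mul, abs_of_nonneg hx, Finset.mul_sum]

lemma rescaled_mem_goodEvent (hd : 0 < d) {f g lam rho : ℝ → ℝ} (hs : IsScaling f g lam rho)
    (c : ℝ) (n : ℕ) : ∀ᶠ t in atTop, ∀ ω,
      rescaled γ ξ Z₁ Z₂ 0 t ω ∈ separatedPairs d n →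
      rescaled γ ξ Z₁ Z₂ c t ω ∈ separatedPairs d n → ω ∈ goodEvent γ ξ Z₁ Z₂ f g lam c t := by
  have hn : (0 : ℝ) < 1 / (n + 1 : ℝ) := by positivity
  have hratio := tendsto_dScale_rScale_div hd γ
  filter_upwards [rScale_pos γ, dScale_pos hd γ, (tendsto_rScale γ).eventually (dScale_pos hd γ),
    hs.f_tendsto.eventually (gt_mem_nhds hn),
    -- The half here and the factor 2 in the next bound absorb the ratio d_{r_t}/d_t, which lies
    -- between 1/2 and 2; the extra 1 gives n < g t also for n = 0.
    hs.lam_tendsto.eventually (gt_mem_nhds (half_pos hn)),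
    hs.g_tendsto.eventually_gt_atTop (2 * n + 1),
    hratio.eventually (lt_mem_nhds (by norm_num : (1 / 2 : ℝ) < 1)),
    hratio.eventually (gt_mem_nhds (by norm_num : (1 : ℝ) < 2))]
    with t hr hδ hδr hf hlam hg hlo hhi ω h0 hc
  obtain ⟨a1, a2, a3, -, a5, a6⟩ := h0
  obtain ⟨-, -, b3, b4, -, -⟩ := hc
  simp only [rescaled] at a1 a2 a3 a5 a6 b3 b4
  rw [l1_smul (inv_nonneg.2 hr.le)] at a1 a3 b3 b4
  rw [← div_sub_div_same] at a2
  have hn0 : (0 : ℝ) ≤ n := Nat.cast_nonneg n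
  rw [lt_div_iff₀ hδ] at hlo
  rw [div_lt_iff₀ hδ] at hhi
  have hng : (n : ℝ) < g t := by linarith
  rw [inv_mul_lt_iff₀ hr] at a3 b3 b4
  rw [lt_inv_mul_iff₀ hr] at a1
  rw [lt_div_iff₀ hδr] at a5 a6
  have hrg : rScale γ t * n < rScale γ t * g t := mul_lt_mul_of_pos_left hng hr
  have hdg : n * dScale d γ (rScale γ t) ≤ dScale d γ t * g t := by
    nlinarith
  refine ⟨(mul_lt_mul_of_pos_left hf hr).trans a1, a3.trans hrg, ?_, by linarith, by linarith,
    b3.trans hrg, b4.trans hrg⟩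
  rw [← sub_div, ← sub_div, sub_sub_sub_cancel_right, lt_div_iff₀ hδr] at a2
  nlinarith

/-! ### Convergence in law -/

variable [MeasurableSpace Ω] {P : Measure Ω}

lemma measurableSet_topPairEvent (hξ : IsWeibullPotential P γ ξ) (r a δ κ : ℝ)
    {G : Set ((Fin d → ℝ) × ℝ × (Fin d → ℝ) × ℝ)} (hG : MeasurableSet G) (z₁ z₂ : Fin d → ℤ) :
    MeasurableSet (topPairEvent ξ r a δ κ G z₁ z₂) := by
  have hm := hξ.measurable
  have h1 : Measurable fun ω => ((z₁, ξ z₁ ω), (z₂, ξ z₂ ω)) := by fun_prop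
  have h2 : MeasurableSet {ω | ∀ z, z ≠ z₁ → z ≠ z₂ →
      ξ z ω - κ * l1 (toReal z) < ξ z₂ ω - κ * l1 (toReal z₂)} := by
    simp only [Set.ofPred_forall]
    exact MeasurableSet.iInter fun z => MeasurableSet.iInter fun _ => MeasurableSet.iInter fun _ =>
      measurableSet_lt (by fun_prop) (by fun_prop)
  exact (h1 (measurableSet_orderedPairs r a δ κ hG)).inter h2

/-- A strict top pair is unique, so the events are disjoint and their probabilities add up. On each
event maximisers exist, hence almost surely the chosen points are that pair. -/
lemma tsum_topPairEvent_le (hξ : IsWeibullPotential P γ ξ)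
    (hZ : IsMaximiserChoice P γ ξ Z₁ Z₂) (c : ℝ)
    {G : Set ((Fin d → ℝ) × ℝ × (Fin d → ℝ) × ℝ)} (hG : MeasurableSet G) :
    ∀ᶠ t in atTop, ∑' z₁, ∑' z₂, P (topPairEvent ξ (rScale γ t) (aScale d γ (rScale γ t))
      (dScale d γ (rScale γ t)) (slope γ c t) G z₁ z₂) ≤
        P (rescaled γ ξ Z₁ Z₂ c t ⁻¹' G) := by
  filter_upwards [hZ.fst c, hZ.snd c] with t h1 h2
  set E : (Fin d → ℤ) × (Fin d → ℤ) → Set Ω := fun p => topPairEvent ξ (rScale γ t)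
    (aScale d γ (rScale γ t)) (dScale d γ (rScale γ t)) (slope γ c t) G p.1 p.2 with hE
  have hEm : ∀ p, MeasurableSet (E p) := fun p =>
    measurableSet_topPairEvent hξ _ _ _ _ hG p.1 p.2
  have hdisj : Pairwise (Function.onFun Disjoint E) := by
    rintro ⟨z₁, z₂⟩ ⟨w₁, w₂⟩ hne
    refine Set.disjoint_left.2 fun ω hz hw => hne ?_
    have hz' := isStrictTopPair_of_mem_topPairEvent hz
    have hw' := isStrictTopPair_of_mem_topPairEvent hw
    have e1 : z₁ = w₁ := hw'.eq_fst hz'.isFirstMaximiser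
    subst e1
    have e2 : z₂ = w₂ := hw'.eq_snd hz'.isSecondMaximiser
    rw [e2]
  rw [← ENNReal.tsum_prod (f := fun z₁ z₂ => P (topPairEvent ξ (rScale γ t)
    (aScale d γ (rScale γ t)) (dScale d γ (rScale γ t)) (slope γ c t) G z₁ z₂))]
  change ∑' p, P (E p) ≤ _
  rw [← measure_iUnion hdisj hEm]
  refine measure_mono_ae ?_
  filter_upwards [h1, h2] with ω h3 h4 h5
  obtain ⟨⟨z₁, z₂⟩, hp⟩ := Set.mem_iUnion.1 h5
  have htop := isStrictTopPair_of_mem_topPairEvent hp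
  have e1 := htop.eq_fst (h3 ⟨z₁, htop.isFirstMaximiser⟩)
  -- The second choice is defined relative to the chosen first point, which must be identified with
  -- z₁ before uniqueness of the second can be used.
  rw [e1] at h4
  have e2 := htop.eq_snd (h4 ⟨z₂, htop.isSecondMaximiser⟩)
  have hmem := hp.1.2.2
  change rescaled γ ξ Z₁ Z₂ c t ω ∈ G
  rw [rescaled, e1, e2, Psi_eq_sub_slope, Psi_eq_sub_slope]
  exact hmem

lemma limitLaw_le_liminf_rescaled [IsProbabilityMeasure P] (hd : 0 < d) (hγ : 0 < γ)
    (hξ : IsWeibullPotential P γ ξ) (hZ : IsMaximiserChoice P γ ξ Z₁ Z₂) (c : ℝ)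
    {G : Set ((Fin d → ℝ) × ℝ × (Fin d → ℝ) × ℝ)} (hG : IsOpen G) :
    limitLaw d γ G ≤ liminf (fun t => P (rescaled γ ξ Z₁ Z₂ c t ⁻¹' G)) atTop :=
  ((isExtremalScale_rScale hd hγ c).limitLaw_le_liminf hd hγ hξ hG).trans
    (liminf_le_liminf (tsum_topPairEvent_le hξ hZ c hG.measurableSet))

lemma aemeasurable_rescaled (hξ : IsWeibullPotential P γ ξ)
    (hZ : IsMaximiserChoice P γ ξ Z₁ Z₂) (c t : ℝ) :
    AEMeasurable (rescaled γ ξ Z₁ Z₂ c t) P := by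
  have hpsi : ∀ Z : Ω → (Fin d → ℤ), AEMeasurable Z P →
      AEMeasurable (fun ω => Psi γ (ξ · ω) c t (Z ω)) P := fun Z hZm => by
    have hm : Measurable fun p : (Fin d → ℤ) × Ω => Psi γ (ξ · p.2) c t p.1 := by
      refine measurable_from_prod_countable_right fun z => ?_
      have := hξ.measurable z
      simp only [Psi]
      fun_prop
    exact hm.comp_aemeasurable (hZm.prodMk aemeasurable_id)
  have hpos : ∀ Z : Ω → (Fin d → ℤ), AEMeasurable Z P →
      AEMeasurable (fun ω => (rScale γ t)⁻¹ • toReal (Z ω)) P := fun Z hZm =>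
    (measurable_of_countable fun z : Fin d → ℤ => (rScale γ t)⁻¹ • toReal z).comp_aemeasurable hZm
  have h1 := hZ.aemeasurable_fst c t
  have h2 := hZ.aemeasurable_snd c t
  exact (hpos _ h1).prodMk ((((hpsi _ h1).sub_const _).div_const _).prodMk
    ((hpos _ h2).prodMk (((hpsi _ h2).sub_const _).div_const _)))

lemma tendstoInDistribution_rescaled [IsProbabilityMeasure P]
    [IsProbabilityMeasure (limitLaw d γ)] (hd : 0 < d) (hγ : 0 < γ)
    (hξ : IsWeibullPotential P γ ξ) (hZ : IsMaximiserChoice P γ ξ Z₁ Z₂) (c : ℝ) :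
    TendstoInDistribution (rescaled γ ξ Z₁ Z₂ c) atTop id (fun _ => P) (limitLaw d γ) where
  forall_aemeasurable := aemeasurable_rescaled hξ hZ c
  aemeasurable_limit := aemeasurable_id
  tendsto := by
    -- Portmanteau theorem: lower bounds on open sets suffice because both sides are probability
    -- measures.
    refine tendsto_of_forall_isOpen_le_liminf' fun G hG => ?_
    simp only [ProbabilityMeasure.coe_mk, Measure.map_id]
    refine (limitLaw_le_liminf_rescaled hd hγ hξ hZ c hG).trans (liminf_le_liminf ?_)
    exact Eventually.of_forall fun t => (Measure.map_apply_of_aemeasurable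
      (aemeasurable_rescaled hξ hZ c t) hG.measurableSet).ge

/-! ### Probability of the good event -/

/-- Continuity from below picks an n with limit mass above η, and the liminf bound for the open set
G n transfers this to large t. -/
lemma eventually_le_prob_of_lt [IsProbabilityMeasure P] (hd : 0 < d) (hγ : 0 < γ)
    (hξ : IsWeibullPotential P γ ξ) (hZ : IsMaximiserChoice P γ ξ Z₁ Z₂) (c : ℝ)
    {G : ℕ → Set ((Fin d → ℝ) × ℝ × (Fin d → ℝ) × ℝ)} (hG : ∀ n, IsOpen (G n))
    (hmono : Monotone G) (hunion : limitLaw d γ (⋃ n, G n) = 1) {η : ENNReal} (hη : η < 1) :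
    ∃ n, ∀ᶠ t in atTop, η < P (rescaled γ ξ Z₁ Z₂ c t ⁻¹' G n) := by
  have hlim := tendsto_measure_iUnion_atTop (μ := limitLaw d γ) hmono
  rw [hunion] at hlim
  obtain ⟨n, hn⟩ := (hlim.eventually (lt_mem_nhds hη)).exists
  exact ⟨n, eventually_lt_of_lt_liminf
    (hn.trans_le (limitLaw_le_liminf_rescaled hd hγ hξ hZ c (hG n)))⟩

lemma tendsto_prob_goodEvent [IsProbabilityMeasure P] (hd : 0 < d) (hγ : 0 < γ)
    (hξ : IsWeibullPotential P γ ξ) (hZ : IsMaximiserChoice P γ ξ Z₁ Z₂) (c : ℝ)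
    {f g lam rho : ℝ → ℝ} (hs : IsScaling f g lam rho) :
    Tendsto (fun t => P (goodEvent γ ξ Z₁ Z₂ f g lam c t)) atTop (𝓝 1) := by
  refine tendsto_order.2 ⟨fun b hb => ?_, fun b hb =>
    Eventually.of_forall fun t => prob_le_one.trans_lt hb⟩
  -- One ε for each of the parameters 0 and c, whose exceptional events are joined by a union bound.
  -- No joint law is needed.
  obtain ⟨ε, hε0, hε⟩ : ∃ ε : ENNReal, 0 < ε ∧ b < 1 - (ε + ε) := by
    have hlim : Tendsto (fun ε : ENNReal => 1 - (ε + ε)) (𝓝[>] 0) (𝓝 1) := by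
      have h1 : Tendsto (fun ε : ENNReal => ε) (𝓝[>] 0) (𝓝 0) := nhdsWithin_le_nhds
      have := ENNReal.Tendsto.sub (tendsto_const_nhds (x := (1 : ENNReal)) (f := 𝓝[>] 0))
        (h1.add h1) (Or.inl ENNReal.one_ne_top)
      simpa using this
    obtain ⟨ε, h1, h2⟩ := ((hlim.eventually (lt_mem_nhds hb)).and self_mem_nhdsWithin).exists
    exact ⟨ε, h2, h1⟩
  have hη : 1 - ε < 1 := ENNReal.sub_lt_self ENNReal.one_ne_top one_ne_zero hε0.ne'
  have hex : ∀ c', ∃ n, ∀ᶠ t in atTop,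
      1 - ε < P (rescaled γ ξ Z₁ Z₂ c' t ⁻¹' separatedPairs d n) := fun c' =>
    eventually_le_prob_of_lt hd hγ hξ hZ c' isOpen_separatedPairs monotone_separatedPairs
      (limitLaw_iUnion_separatedPairs hd hγ) hη
  obtain ⟨m, hm⟩ := hex 0
  obtain ⟨k, hk⟩ := hex c
  filter_upwards [hm, hk, rescaled_mem_goodEvent (γ := γ) (ξ := ξ) (Z₁ := Z₁) (Z₂ := Z₂) hd hs c
    (max m k)] with t h1 h2 h3
  have hnull : ∀ c', NullMeasurableSet
      (rescaled γ ξ Z₁ Z₂ c' t ⁻¹' separatedPairs d (max m k)) P := fun c' =>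
    (aemeasurable_rescaled hξ hZ c' t).nullMeasurableSet_preimage
      (isOpen_separatedPairs _).measurableSet
  have hcompl : ∀ c', 1 - ε < P (rescaled γ ξ Z₁ Z₂ c' t ⁻¹' separatedPairs d (max m k)) →
      P (rescaled γ ξ Z₁ Z₂ c' t ⁻¹' separatedPairs d (max m k))ᶜ ≤ ε := fun c' h => by
    rw [prob_compl_eq_one_sub₀ (hnull c')]
    exact tsub_le_iff_tsub_le.1 h.le
  have hA := hcompl 0 (h1.trans_le (measure_mono
    (Set.preimage_mono (monotone_separatedPairs (le_max_left m k)))))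
  have hB := hcompl c (h2.trans_le (measure_mono
    (Set.preimage_mono (monotone_separatedPairs (le_max_right m k)))))
  set A := rescaled γ ξ Z₁ Z₂ 0 t ⁻¹' separatedPairs d (max m k) with hAdef
  set B := rescaled γ ξ Z₁ Z₂ c t ⁻¹' separatedPairs d (max m k) with hBdef
  calc b < 1 - (ε + ε) := hε
    _ ≤ 1 - P (A ∩ B)ᶜ := by
        refine tsub_le_tsub_left ?_ 1
        rw [Set.compl_inter]
        exact (measure_union_le _ _).trans (add_le_add hA hB)
    _ = P (A ∩ B) := by
        rw [← prob_compl_eq_one_sub₀ ((hnull 0).inter (hnull c)).compl, compl_compl]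
    _ ≤ _ := measure_mono fun ω hω => h3 ω hω.1 hω.2

end WeibullPAM

theorem proposition3p2 {d : ℕ} (hd : 0 < d) {γ : ℝ} (hγ : 0 < γ)
    {Ω : Type*} [MeasurableSpace Ω] (P : Measure Ω) [IsProbabilityMeasure P]
    (ξ : (Fin d → ℤ) → Ω → ℝ) (hξ : WeibullPAM.IsWeibullPotential P γ ξ)
    (Z₁ Z₂ : ℝ → ℝ → Ω → (Fin d → ℤ)) (hZ : WeibullPAM.IsMaximiserChoice P γ ξ Z₁ Z₂) (c : ℝ) :
    (∃ (L : Measure ((Fin d → ℝ) × ℝ × (Fin d → ℝ) × ℝ)) (_ : IsProbabilityMeasure L),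
      L = volume.withDensity (fun q => ENNReal.ofReal (WeibullPAM.limitDensity d γ q)) ∧
      TendstoInDistribution (WeibullPAM.rescaled γ ξ Z₁ Z₂ c) atTop id (fun _ => P) L) ∧
    (∀ f g lam rho : ℝ → ℝ, WeibullPAM.IsScaling f g lam rho →
      Tendsto (fun t => P (WeibullPAM.goodEvent γ ξ Z₁ Z₂ f g lam c t)) atTop (𝓝 1)) := by
  have := WeibullPAM.isProbabilityMeasure_limitLaw hd hγ
  exact ⟨⟨WeibullPAM.limitLaw d γ, this, rfl,
    WeibullPAM.tendstoInDistribution_rescaled hd hγ hξ hZ c⟩,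
    fun f g lam rho hs => WeibullPAM.tendsto_prob_goodEvent hd hγ hξ hZ c hs⟩
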